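/- All rings are commutative and noetherian. For a local ring $(R,\mathfrak m)$, an ideal $I$ of $R$ is a \emph{Burch ideal} if $\mathfrak m I\neq \mathfrak m(I:_R\mathfrak m)$. A local ring $(R,\mathfrak m)$ of depth $t$, with $\mathfrak m$-adic completion $\widehat R$, is a \emph{Burch ring} if there exist a maximal $\widehat R$-regular sequence $\boldsymbol x=x_1,\dots,x_t$ in $\widehat R$, a regular local ring $S$ and a Burch ideal $I$ of $S$ such that $\widehat R/(\boldsymbol x)\cong S/I$. For a finitely generated module $M$ over a local ring $R$, $\Omega^i_R M$ denotes the $i$-th syzygy of $M$ in a minimal free resolution of $M$. \textbf{Theorem.} Let $(R,\mathfrak m,k)$ be a noetherian local ring. (1) Suppose that $R$ is not a field. Then $R$ is a Burch ring of depth zero if and only if $k$ is isomorphic to a direct summand of the second syzygy $\Omega^2_R k$. (2) Let $I\neq\mathfrak m$ be a proper ideal of $R$. If $I$ is a Burch ideal, then $k$ is isomorphic to a direct summand of $\Omega^2_{R/I}k$. (3) Suppose that $R$ is regular and let $I\neq\mathfrak m$ be a proper ideal of $R$. Then $I$ is a Burch ideal if and only if $k$ is isomorphic to a direct summand of $\Omega^2_{R/I}k$.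 -/

import Mathlib

universe u v

namespace BurchRings

open IsLocalRing RingTheory.Sequence

/-- An ideal `I` of a local ring `(R, 𝔪)` is a Burch ideal if `𝔪 I ≠ 𝔪 (I : 𝔪)`. -/
def IsBurchIdeal {R : Type u} [CommRing R] [IsLocalRing R] (I : Ideal R) : Prop :=
  maximalIdeal R * I ≠ maximalIdeal R * Submodule.colon I (maximalIdeal R : Set R)

/-- The depth of a (noetherian) local ring `R`: the supremum of the lengths of `R`-regular
sequences. (The terms of a sequence `rs` with `R ≠ (rs)R` lie in the maximal ideal.) -/
noncomputable def depth (R : Type u) [CommRing R] [IsLocalRing R] : ℕ∞ :=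
  ⨆ (rs : List R) (_ : IsRegular R rs), (rs.length : ℕ∞)

/-- A maximal regular sequence on the ring `A`: a regular sequence that cannot be prolonged. -/
def IsMaximalRegularSequence (A : Type u) [CommRing A] (xs : List A) : Prop :=
  IsRegular A xs ∧ ∀ y : A, ¬ IsRegular A (xs ++ [y])

/-- A (noetherian) local ring `R` of depth `t`, with `𝔪`-adic completion `R̂`, is a Burch ring if
there are a maximal `R̂`-regular sequence `xs` of length `t` in `R̂`, a regular local ring `S` and a
Burch ideal `I` of `S` such that `R̂ / (xs) ≅ S / I` as rings. -/
def IsBurchRing (R : Type u) [CommRing R] [IsLocalRing R] : Prop :=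
  ∃ xs : List (AdicCompletion (maximalIdeal R) R),
    IsMaximalRegularSequence (AdicCompletion (maximalIdeal R) R) xs ∧
    (xs.length : ℕ∞) = depth R ∧
    ∃ (S : Type u) (_ : CommRing S) (_ : IsRegularLocalRing S) (I : Ideal S),
      IsBurchIdeal I ∧
      Nonempty ((AdicCompletion (maximalIdeal R) R ⧸ Ideal.ofList xs) ≃+* (S ⧸ I))

/-- A minimal free resolution
`⋯ → R ^ rank 2 → R ^ rank 1 → R ^ rank 0 → M → 0`
of a module `M` over a local ring `R`, by free modules of finite rank. Minimality says that all
entries of the matrices of the differentials lie in the maximal ideal. -/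
structure MinimalFreeResolution (R : Type u) [CommRing R] [IsLocalRing R]
    (M : Type v) [AddCommGroup M] [Module R M] where
  /-- the Betti numbers -/
  rank : ℕ → ℕ
  /-- the augmentation -/
  ε : (Fin (rank 0) → R) →ₗ[R] M
  /-- the differentials; `d i` goes from degree `i + 1` to degree `i` -/
  d : ∀ i : ℕ, (Fin (rank (i + 1)) → R) →ₗ[R] (Fin (rank i) → R)
  surjective_ε : Function.Surjective ε
  exact_ε : Function.Exact (d 0) ε
  exact_d : ∀ i : ℕ, Function.Exact (d (i + 1)) (d i)
  minimal : ∀ (i : ℕ) (v : Fin (rank (i + 1)) → R) (j : Fin (rank i)),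
    d i v j ∈ maximalIdeal R

/-- The `(i + 1)`-st syzygy `Ω^{i+1} M` of `M` in a minimal free resolution of `M`: the image of
the differential from degree `i + 1` to degree `i`. -/
def MinimalFreeResolution.syzygySucc {R : Type u} [CommRing R] [IsLocalRing R]
    {M : Type v} [AddCommGroup M] [Module R M] (F : MinimalFreeResolution R M) (i : ℕ) :
    Submodule R (Fin (F.rank i) → R) :=
  LinearMap.range (F.d i)

/-- The `R`-module `K` is isomorphic to a direct summand of the `R`-module `N`. -/
def IsIsoToDirectSummand (R : Type u) [CommRing R] (K : Type v) [AddCommGroup K] [Module R K]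
    (N : Type u) [AddCommGroup N] [Module R N] : Prop :=
  ∃ P Q : Submodule R N, IsCompl P Q ∧ Nonempty (K ≃ₗ[R] P)

/-- Every finitely generated module over a local ring has a minimal free cover. -/
theorem exists_minimal_cover (R : Type u) [CommRing R] [IsLocalRing R]
    (M : Type v) [AddCommGroup M] [Module R M] [Module.Finite R M] :
    ∃ (n : ℕ) (f : (Fin n → R) →ₗ[R] M), Function.Surjective f ∧
      ∀ v, f v = 0 → ∀ j, v j ∈ maximalIdeal R := by
  classical
  let b := Module.finBasis (ResidueField R) (TensorProduct R (ResidueField R) M)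
  have hs : Function.Surjective (TensorProduct.mk R (ResidueField R) M 1) :=
    TensorProduct.mk_surjective R M (ResidueField R) residue_surjective
  choose g hg using fun i => hs (b i)
  refine ⟨_, Fintype.linearCombination R g, ?_, ?_⟩
  · rw [← LinearMap.range_eq_top, Fintype.range_linearCombination]
    exact span_eq_top_of_tmul_eq_basis g b hg
  · intro v hv j
    rw [Fintype.linearCombination_apply] at hv
    have h1 : ∑ i, residue R (v i) • b i = 0 := by
      have := congrArg (TensorProduct.mk R (ResidueField R) M 1) hv
      rw [map_sum, map_zero] at this
      rw [← this]
      refine Finset.sum_congr rfl fun i _ => ?_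
      rw [map_smul, hg i]
      exact algebraMap_smul (ResidueField R) (v i) (b i)
    have h2 := Fintype.linearIndependent_iff.1 b.linearIndependent _ h1 j
    exact (residue_eq_zero_iff _).1 h2

/-- Over a noetherian local ring, every finitely generated module has a minimal free
resolution. -/
theorem nonempty_minimalFreeResolution (R : Type u) [CommRing R] [IsLocalRing R]
    [IsNoetherianRing R] (M : Type v) [AddCommGroup M] [Module R M] [Module.Finite R M] :
    Nonempty (MinimalFreeResolution R M) := by
  obtain ⟨n₀, f₀, hf₀, hm₀⟩ := exists_minimal_cover R M
  have step : ∀ s : (Σ n : ℕ, Submodule R (Fin n → R)),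
      ∃ (n : ℕ) (f : (Fin n → R) →ₗ[R] (Fin s.1 → R)), LinearMap.range f = s.2 ∧
        ∀ v, f v = 0 → ∀ j, v j ∈ maximalIdeal R := by
    intro s
    obtain ⟨n, f, hf, hm⟩ := exists_minimal_cover R s.2
    refine ⟨n, s.2.subtype ∘ₗ f, ?_, fun v hv => hm v ?_⟩
    · rw [LinearMap.range_comp, LinearMap.range_eq_top.2 hf, Submodule.map_top,
        Submodule.range_subtype]
    · exact Subtype.ext hv
  choose n f hr hm using step
  let st : ℕ → (Σ n : ℕ, Submodule R (Fin n → R)) := fun i =>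
    Nat.rec ⟨n₀, LinearMap.ker f₀⟩ (fun _ s => ⟨n s, LinearMap.ker (f s)⟩) i
  refine ⟨⟨fun i => (st i).1, f₀, fun i => f (st i), hf₀, ?_, ?_, ?_⟩⟩
  · exact LinearMap.exact_iff.2 (hr (st 0)).symm
  · intro i
    exact LinearMap.exact_iff.2 (hr (st (i + 1))).symm
  · intro i v j
    have hv : f (st i) v ∈ (st i).2 := hr (st i) ▸ LinearMap.mem_range_self _ v
    cases i with
    | zero => exact hm₀ _ hv j
    | succ i => exact hm (st i) _ hv j

end BurchRings

/-!
Everything is reduced to a criterion for the residue field `k` of a local ring `A` to split off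
from the second syzygy of `k`. That syzygy is the kernel of a cover `φ : A ^ n → 𝔪` of the maximal
ideal, and `k` is a summand of it exactly when some `s e`, with `s` in the socle of `A` and `e` a
vector, lies outside `𝔪 (ker φ)`: this is `HasSocleGenerator φ`, see
`isIsoToDirectSummand_ker_iff`. Unless `A` is a field, the condition does not depend on `φ`.

Let `A = S / I` with `I ≠ 𝔪`. If `I` is a Burch ideal, an element `y a ∉ 𝔪 I` with `y ∈ 𝔪` and
`a ∈ I : 𝔪` yields a socle generator (`IsBurchIdeal.hasSocleGenerator`). Let conversely `S` be
regular, and let `x` be a regular system of parameters of `S`. Killing elements of `I` outside `𝔪²`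
one reduces to `I ⊆ 𝔪²` (`isBurchIdeal_of_isBurchIdeal_map`). If `𝔪 (I : 𝔪) = 𝔪 I` holds, then
`𝔪 (I : 𝔪) ⊆ 𝔪³`, hence `I : 𝔪 ⊆ 𝔪²` because an element of `𝔪` outside `𝔪²` has a regular initial
form. So for `s` in `I : 𝔪` the vector `s e` has coordinates in `𝔪²`, and `∑ s eᵢ xᵢ` lies in `𝔪 I`;
subtracting an element of `𝔪` times the syzygies modulo `I`, also with coordinates in `𝔪²`, one
gets a syzygy of `x` with coordinates in `𝔪²`. Such a syzygy is an `𝔪`-combination of Koszul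
relations (`IsRegularParameters.mem_smul_ker`), and so there is no socle generator
(`isBurchIdeal_of_ker_le_sq`).

A local ring `R` of depth zero is a Burch ring if its completion is the quotient `S / I` of a
regular local ring `S` by a Burch ideal `I`. Socle generators pass between `R` and its completion by
approximation (`IsDenseLocalHom.hasSocleGenerator_map`, `IsDenseLocalHom.hasSocleGenerator_of_map`).
That the completion of `R` is a quotient of a regular local ring at all is part of Cohen's structure
theorem, proved here without coefficient rings (`exists_regular_surjection`). A complete local ring
`A` is the image of a localization `L` of a polynomial ring over `ℤ` in as many variables as `A` has
elements, a directed union of regular local rings. Killing elements of the kernel of `L → A` that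
are independent modulo `𝔪²` and span its image in `𝔪 / 𝔪²` leaves a local ring whose maximal ideal
is generated modulo its square by finitely many elements, with the regularity properties of a
regular system of parameters; its completion is regular and still maps onto `A`.
-/

namespace BurchRings

open IsLocalRing

/-! ### Regular systems of parameters -/

/-- A regular system of parameters of a local ring `B`: a finite family that generates the maximal
ideal and has at most `dim B` members. -/
structure IsRegularParameters {B : Type*} [CommRing B] [IsLocalRing B] {ι : Type*} [Fintype ι]
    (x : ι → B) : Prop where
  span_eq : Ideal.span (Set.range x) = maximalIdeal B
  card_le : (Fintype.card ι : WithBot ℕ∞) ≤ ringKrullDim B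

theorem exists_isRegularParameters (B : Type*) [CommRing B] [IsRegularLocalRing B] :
    ∃ (d : ℕ) (x : Fin d → B), IsRegularParameters x := by
  have hfg := (maximalIdeal B).fg_of_isNoetherianRing
  obtain ⟨s, hs, hs'⟩ := Submodule.FG.exists_span_finset_card_eq_spanFinrank hfg
  refine ⟨s.card, fun i => s.equivFin.symm i, ?_, ?_⟩
  · rw [← hs', Ideal.span]
    congr 1
    ext a
    constructor
    · rintro ⟨i, rfl⟩
      exact (s.equivFin.symm i).2
    · intro ha
      exact ⟨s.equivFin ⟨a, ha⟩, by simp⟩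
  · rw [Fintype.card_fin, hs, IsRegularLocalRing.spanFinrank_maximalIdeal]

section

variable {B : Type*} [CommRing B] [IsLocalRing B] [IsNoetherianRing B]
  {ι : Type*} [Fintype ι] {x : ι → B}

omit [IsNoetherianRing B] in
theorem spanFinrank_maximalIdeal_le_card (hx : Ideal.span (Set.range x) = maximalIdeal B) :
    (maximalIdeal B).spanFinrank ≤ Fintype.card ι := by
  rw [← hx]
  refine (Submodule.spanFinrank_span_le_ncard_of_finite (Set.finite_range x)).trans ?_
  rw [← Set.image_univ, ← Nat.card_eq_fintype_card, ← Set.ncard_univ]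
  exact Set.ncard_image_le Set.finite_univ

theorem IsRegularParameters.isRegularLocalRing (hx : IsRegularParameters x) :
    IsRegularLocalRing B := by
  refine IsRegularLocalRing.of_spanFinrank_maximalIdeal_le B (le_trans ?_ hx.card_le)
  exact_mod_cast spanFinrank_maximalIdeal_le_card hx.span_eq

omit [IsNoetherianRing B] in
theorem IsRegularParameters.mem (hx : IsRegularParameters x) (i : ι) : x i ∈ maximalIdeal B :=
  hx.span_eq ▸ Ideal.subset_span ⟨i, rfl⟩

omit [IsNoetherianRing B] in
theorem IsRegularParameters.span_image_le (hx : IsRegularParameters x) (C : Set ι) :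
    Ideal.span (x '' C) ≤ maximalIdeal B :=
  Ideal.span_le.2 (by rintro _ ⟨i, -, rfl⟩; exact hx.mem i)

omit [IsNoetherianRing B] in
theorem isLocalRing_quotient {I : Ideal B} (hI : I ≤ maximalIdeal B) : IsLocalRing (B ⧸ I) :=
  have : Nontrivial (B ⧸ I) := Ideal.Quotient.nontrivial_iff.2 fun h =>
    (maximalIdeal.isMaximal B).ne_top (top_le_iff.1 (h ▸ hI))
  IsLocalRing.of_surjective' (Ideal.Quotient.mk I) Ideal.Quotient.mk_surjective

theorem IsRegularParameters.quotient (hx : IsRegularParameters x) (C : Finset ι)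
    [IsLocalRing (B ⧸ Ideal.span (x '' C))] [Fintype {i // i ∉ C}] :
    IsRegularParameters fun i : {i // i ∉ C} => Ideal.Quotient.mk (Ideal.span (x '' C)) (x i) := by
  classical
  constructor
  · rw [← map_maximalIdeal_of_surjective (Ideal.Quotient.mk (Ideal.span (x '' C)))
        Ideal.Quotient.mk_surjective, ← hx.span_eq,
      Ideal.map_span]
    refine le_antisymm (Ideal.span_mono ?_) (Ideal.span_le.2 ?_)
    · rintro _ ⟨i, rfl⟩
      exact Set.mem_image_of_mem _ (Set.mem_range_self _)
    · rintro _ ⟨_, ⟨i, rfl⟩, rfl⟩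
      by_cases hi : i ∈ C
      · have h0 : Ideal.Quotient.mk (Ideal.span (x '' C)) (x i) = 0 :=
          Ideal.Quotient.eq_zero_iff_mem.2 (Ideal.subset_span (Set.mem_image_of_mem x hi))
        rw [h0]
        exact zero_mem _
      · exact Ideal.subset_span ⟨⟨i, hi⟩, rfl⟩
  · have h1 := ringKrullDim_le_ringKrullDim_quotient_add_card (R := B) (C.image x) (by
      rw [IsLocalRing.ringJacobson_eq_maximalIdeal]
      intro a ha
      obtain ⟨i, -, rfl⟩ := Finset.mem_image.1 (Finset.mem_coe.1 ha)
      exact hx.mem i)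
    rw [Finset.coe_image] at h1
    have h2 : (Fintype.card {i // i ∉ C} : WithBot ℕ∞) + (C.card : ℕ) ≤
        ringKrullDim (B ⧸ Ideal.span (x '' C)) + (C.card : ℕ) := by
      have h3 : Fintype.card {i // i ∉ C} + C.card = Fintype.card ι := by
        rw [Fintype.card_subtype_compl, Fintype.card_coe]
        exact Nat.sub_add_cancel (Finset.card_le_univ C)
      calc _ = ((Fintype.card ι : ℕ) : WithBot ℕ∞) := by rw [← h3]; push_cast; rfl
        _ ≤ _ := hx.card_le
        _ ≤ _ := h1
        _ ≤ _ := by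
          gcongr
          exact_mod_cast Finset.card_image_le
    exact ENat.WithBot.add_le_add_natCast_right_iff.1 h2

theorem IsRegularParameters.isRegularLocalRing_quotient (hx : IsRegularParameters x)
    (C : Finset ι) : IsRegularLocalRing (B ⧸ Ideal.span (x '' C)) := by
  classical
  have := isLocalRing_quotient (hx.span_image_le C)
  exact (hx.quotient C).isRegularLocalRing

omit [Fintype ι] in
/-- By Nakayama's lemma, a member of a generating family of the maximal ideal that is congruent
modulo `𝔪²` to a combination of the others is redundant. -/
theorem span_image_compl_eq {i : ι} (hx : Ideal.span (Set.range x) = maximalIdeal B)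
    (hi : x i ∈ Ideal.span (x '' {i}ᶜ) ⊔ maximalIdeal B ^ 2) :
    Ideal.span (x '' {i}ᶜ) = maximalIdeal B := by
  refine le_antisymm (hx ▸ Ideal.span_mono (Set.image_subset_range _ _)) ?_
  refine Submodule.le_of_le_smul_of_le_jacobson_bot (maximalIdeal B).fg_of_isNoetherianRing
    (maximalIdeal_le_jacobson ⊥) ?_
  rw [smul_eq_mul, ← pow_two]
  conv_lhs => rw [← hx]
  refine Ideal.span_le.2 ?_
  rintro _ ⟨j, rfl⟩
  by_cases hj : j = i
  · exact hj ▸ hi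
  · exact Ideal.mem_sup_left (Ideal.subset_span ⟨j, hj, rfl⟩)

theorem IsRegularParameters.notMem (hx : IsRegularParameters x) (i : ι) :
    x i ∉ Ideal.span (x '' {i}ᶜ) ⊔ maximalIdeal B ^ 2 := by
  classical
  intro hi
  have h := span_image_compl_eq hx.span_eq hi
  have h1 : Ideal.span (Set.range fun j : {j // j ≠ i} => x j) = maximalIdeal B := by
    rw [← h]
    congr 1
    ext a
    simp
  have h2 := spanFinrank_maximalIdeal_le_card h1
  have h3 := hx.card_le.trans (ringKrullDim_le_spanFinrank_maximalIdeal B)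
  have h4 : Fintype.card ι ≤ (maximalIdeal B).spanFinrank := by exact_mod_cast h3
  have h5 := Fintype.card_subtype_lt (p := fun j => j ≠ i) (x := i) (by simp)
  omega

omit [IsNoetherianRing B] in
/-- Any element of `𝔪 \ 𝔪²` can replace some member of a regular system of parameters. -/
theorem IsRegularParameters.exists_update [DecidableEq ι] (hx : IsRegularParameters x) {y : B}
    (hy : y ∈ maximalIdeal B) (hy' : y ∉ maximalIdeal B ^ 2) :
    ∃ i, IsRegularParameters (Function.update x i y) := by
  have h := hy
  rw [← hx.span_eq, Ideal.mem_span_range_iff_exists_fun] at h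
  obtain ⟨c, rfl⟩ := h
  obtain ⟨i, hi⟩ : ∃ i, IsUnit (c i) := by
    by_contra! hc
    refine hy' (sum_mem fun i _ => ?_)
    rw [pow_two]
    exact Ideal.mul_mem_mul ((mem_maximalIdeal _).2 (hc i)) (hx.mem i)
  refine ⟨i, le_antisymm (Ideal.span_le.2 ?_) ?_, hx.card_le⟩
  · rintro _ ⟨j, rfl⟩
    by_cases hj : j = i
    · subst hj
      simpa using hy
    · rw [Function.update_of_ne hj]
      exact hx.mem j
  · have hne : ∀ j, j ≠ i → x j ∈
        Ideal.span (Set.range (Function.update x i (∑ k, c k * x k))) := fun j hj =>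
      Ideal.subset_span ⟨j, Function.update_of_ne hj _ _⟩
    rw [← hx.span_eq]
    refine Ideal.span_le.2 ?_
    rintro _ ⟨j, rfl⟩
    by_cases hj : j = i
    · subst hj
      refine (Ideal.unit_mul_mem_iff_mem _ hi).1 ?_
      have h1 : ∑ k, c k * x k ∈
          Ideal.span (Set.range (Function.update x j (∑ k, c k * x k))) :=
        Ideal.subset_span ⟨j, Function.update_self _ _ _⟩
      have h2 := Finset.add_sum_erase _ (fun k => c k * x k) (Finset.mem_univ j)
      rw [← eq_sub_iff_add_eq] at h2
      rw [h2]
      exact sub_mem h1 (sum_mem fun k hk =>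
        Ideal.mul_mem_left _ _ (hne k (Finset.ne_of_mem_erase hk)))
    · exact hne j hj

end

/-- A regular local ring modulo an element of `𝔪 \ 𝔪²` is regular. -/
theorem isRegularLocalRing_quotient_span_singleton {B : Type*} [CommRing B] [IsRegularLocalRing B]
    {y : B} (hy : y ∈ maximalIdeal B) (hy' : y ∉ maximalIdeal B ^ 2) :
    IsRegularLocalRing (B ⧸ Ideal.span {y}) := by
  obtain ⟨d, x, hx⟩ := exists_isRegularParameters B
  obtain ⟨i, hi⟩ := hx.exists_update hy hy'
  have := hi.isRegularLocalRing_quotient {i}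
  rwa [Finset.coe_singleton, Set.image_singleton, Function.update_self] at this

/-- Regular local rings are domains, by induction on the dimension. An element `y` of `𝔪` outside
`𝔪²` and outside all minimal primes generates a prime ideal, and a minimal prime `p` below it
satisfies `p = y p`. -/
theorem isDomain_of_card (n : ℕ) : ∀ (B : Type u) [CommRing B] [IsLocalRing B]
    [IsNoetherianRing B] (ι : Type) [Fintype ι] (x : ι → B), IsRegularParameters x →
    Fintype.card ι = n → IsDomain B := by
  classical
  induction n with
  | zero =>
    intro B _ _ _ ι _ x hx hn
    have := Fintype.card_eq_zero_iff.1 hn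
    have h := hx.span_eq
    rw [Set.range_eq_empty, Ideal.span_empty] at h
    exact ((isField_iff_maximalIdeal_eq).2 h.symm).isDomain
  | succ n ih =>
    intro B _ _ _ ι _ x hx hn
    have hdim : (1 : WithBot ℕ∞) ≤ ringKrullDim B := by
      refine le_trans ?_ hx.card_le
      rw [hn]
      exact_mod_cast Nat.succ_le_succ (Nat.zero_le n)
    have hfin := Ideal.finite_minimalPrimes_of_isNoetherianRing B ⊥
    -- prime avoidance, which tolerates `𝔪²` as one ideal that is not prime
    obtain ⟨y, hy, hy2⟩ : ∃ y ∈ maximalIdeal B,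
        y ∉ ⋃ J ∈ (↑(insert (maximalIdeal B ^ 2) hfin.toFinset) : Set (Ideal B)),
          ((J : Ideal B) : Set B) := by
      by_contra! hcon
      obtain ⟨J, hJ, hle⟩ := (Ideal.subset_union_prime (f := id) (maximalIdeal B ^ 2)
        (maximalIdeal B ^ 2) (by
          intro J hJ h _
          have := (Finset.mem_insert.1 hJ).resolve_left h
          exact (hfin.mem_toFinset.1 this).isPrime)).1 hcon
      rcases Finset.mem_insert.1 hJ with rfl | hJ
      · obtain ⟨i⟩ : Nonempty ι := Fintype.card_pos_iff.1 (by omega)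
        exact hx.notMem i (Ideal.mem_sup_right (hle (hx.mem i)))
      · have hmin := hfin.mem_toFinset.1 hJ
        have hp := hmin.isPrime
        have hEq : J = maximalIdeal B := le_antisymm (le_maximalIdeal hp.ne_top) hle
        have h0 : (maximalIdeal B).height = 0 := by
          rw [← hEq]
          exact Ideal.height_eq_zero_iff.2 hmin
        rw [← maximalIdeal_height_eq_ringKrullDim, h0] at hdim
        exact absurd hdim (by decide)
    rw [Set.mem_iUnion₂] at hy2
    push Not at hy2
    obtain ⟨i, hi⟩ := hx.exists_update hy (hy2 _ (Finset.mem_insert_self _ _))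
    have hspan : Function.update x i y '' ({i} : Finset ι) = {y} := by simp
    have := hi.isRegularLocalRing_quotient {i}
    have hdom := ih (B ⧸ Ideal.span (Function.update x i y '' ({i} : Finset ι))) _ _
      (hi.quotient {i}) (by simp [hn])
    rw [hspan, Ideal.Quotient.isDomain_iff_prime] at hdom
    obtain ⟨p, hp, hle⟩ := Ideal.exists_minimalPrimes_le (I := ⊥) (J := Ideal.span {y}) bot_le
    have hpp : p.IsPrime := hp.isPrime
    have hyp : y ∉ p := hy2 p (Finset.mem_insert_of_mem (hfin.mem_toFinset.2 hp))
    have h0 : p = ⊥ := by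
      refine Submodule.eq_bot_of_le_smul_of_le_jacobson_bot (maximalIdeal B) p
        p.fg_of_isNoetherianRing (fun a ha => ?_) (maximalIdeal_le_jacobson ⊥)
      obtain ⟨b, rfl⟩ := Ideal.mem_span_singleton'.1 (hle ha)
      rw [mul_comm]
      exact Ideal.mul_mem_mul hy ((hpp.mem_or_mem ha).resolve_right hyp)
    rw [h0] at hpp
    exact IsDomain.of_bot_isPrime B

theorem isDomain_of_isRegularLocalRing (B : Type u) [CommRing B] [IsRegularLocalRing B] :
    IsDomain B := by
  obtain ⟨d, x, hx⟩ := exists_isRegularParameters B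
  exact isDomain_of_card _ B _ x hx rfl

section

variable {B : Type u} [CommRing B] [IsLocalRing B] [IsNoetherianRing B]
  {ι : Type*} [Fintype ι] {x : ι → B}

theorem IsRegularParameters.mem_span_image_of_mul_mem (hx : IsRegularParameters x) {C : Finset ι}
    {i : ι} (hi : i ∉ C) {u : B} (h : x i * u ∈ Ideal.span (x '' C)) :
    u ∈ Ideal.span (x '' C) := by
  have := hx.isRegularLocalRing_quotient C
  have := isDomain_of_isRegularLocalRing (B ⧸ Ideal.span (x '' C))
  have hp := (Ideal.Quotient.isDomain_iff_prime _).1 this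
  refine (hp.mem_or_mem h).resolve_left fun hmem => hx.notMem i (Ideal.mem_sup_left ?_)
  refine Ideal.span_mono (Set.image_mono ?_) hmem
  intro j hj hji
  exact hi (hji ▸ hj)

/-- In a regular system of parameters each member is regular modulo the powers of an ideal
generated by others, also after killing some further ones. The induction on `E` splits off one
generator `z`: if `𝔟 = 𝔞 + (z)`, then `𝔟ⁿ⁺¹ = 𝔞ⁿ⁺¹ + z 𝔟ⁿ`. -/
theorem IsRegularParameters.mem_of_mul_mem [DecidableEq ι] (hx : IsRegularParameters x)
    (E : Finset ι) :
    ∀ (C : Finset ι) (i : ι) (n : ℕ) (u : B), Disjoint C E → i ∉ C → i ∉ E →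
      x i * u ∈ Ideal.span (x '' C) ⊔ Ideal.span (x '' E) ^ n →
      u ∈ Ideal.span (x '' C) ⊔ Ideal.span (x '' E) ^ n := by
  induction E using Finset.induction_on with
  | empty =>
    intro C i n u _ hi _ h
    cases n with
    | zero => simp
    | succ n =>
      simp only [Finset.coe_empty, Set.image_empty, Ideal.span_empty, pow_succ, Ideal.mul_bot,
        sup_bot_eq] at h ⊢
      exact hx.mem_span_image_of_mul_mem hi h
  | insert z E hz ih =>
    intro C i n u hd hiC hiE h
    rw [Finset.mem_insert, not_or] at hiE
    rw [Finset.disjoint_insert_right] at hd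
    set c := Ideal.span (x '' C)
    set a := Ideal.span (x '' E)
    set b := Ideal.span (x '' (insert z E : Finset ι)) with hb
    have hba : b = Ideal.span {x z} ⊔ a := by
      rw [hb, Finset.coe_insert, Set.image_insert_eq, Ideal.span_insert]
    have hab : a ≤ b := hba ▸ le_sup_right
    have hzb : x z ∈ b := hba ▸ Ideal.mem_sup_left (Ideal.mem_span_singleton_self _)
    have hpow : ∀ n, b ^ (n + 1) ≤ a ^ (n + 1) ⊔ Ideal.span {x z} * b ^ n := by
      intro n
      induction n with
      | zero => simp [hba, sup_comm]
      | succ n ihn =>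
        calc b ^ (n + 1 + 1) = b ^ (n + 1) * (Ideal.span {x z} ⊔ a) := by rw [pow_succ, hba]
          _ ≤ _ := by
            rw [Ideal.mul_sup, mul_comm (b ^ (n + 1)) (Ideal.span _)]
            refine sup_le le_sup_right ((Ideal.mul_mono_left ihn).trans ?_)
            rw [Ideal.sup_mul, ← pow_succ, mul_assoc]
            refine sup_le_sup le_rfl (Ideal.mul_mono_right ?_)
            rw [pow_succ]
            exact Ideal.mul_mono_right hab
    have hCz : Ideal.span (x '' (insert z C : Finset ι)) = c ⊔ Ideal.span {x z} := by
      rw [Finset.coe_insert, Set.image_insert_eq, Ideal.span_insert, sup_comm]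
    induction n generalizing u with
    | zero => simp
    | succ n ihn =>
      have h1 : u ∈ c ⊔ Ideal.span {x z} ⊔ a ^ (n + 1) := by
        rw [← hCz]
        refine ih (insert z C) i (n + 1) u (Finset.disjoint_insert_left.2 ⟨hz, hd.2⟩)
          (by simp [hiE.1, hiC]) hiE.2 ?_
        rw [hCz]
        refine (sup_le (le_sup_left.trans le_sup_left) ((hpow n).trans ?_) : _ ≤ _) h
        exact sup_le le_sup_right
          (Ideal.mul_le_left.trans (le_sup_right.trans le_sup_left))
      obtain ⟨t, ht, a', ha', rfl⟩ := Submodule.mem_sup.1 h1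
      obtain ⟨c', hc', s, hs, rfl⟩ := Submodule.mem_sup.1 ht
      obtain ⟨v, rfl⟩ := Ideal.mem_span_singleton'.1 hs
      have ha2 : a' ∈ b ^ (n + 1) := Ideal.pow_right_mono hab _ ha'
      have h2 : x z * (x i * v) ∈ c ⊔ b ^ (n + 1) := by
        have e : x z * (x i * v) = x i * (c' + v * x z + a') - (x i * c' + x i * a') := by ring
        rw [e]
        exact sub_mem h (add_mem (Ideal.mem_sup_left (Ideal.mul_mem_left _ _ hc'))
          (Ideal.mem_sup_right (Ideal.mul_mem_left _ _ ha2)))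
      obtain ⟨c2, hc2, w, hw, hw'⟩ := Submodule.mem_sup.1 h2
      obtain ⟨a3, ha3, w3, hw3, rfl⟩ := Submodule.mem_sup.1 (hpow n hw)
      obtain ⟨w4, hw4, rfl⟩ := Ideal.mem_span_singleton_mul.1 hw3
      have h3 : x i * v - w4 ∈ c ⊔ a ^ (n + 1) := by
        refine ih C z (n + 1) _ hd.2 hd.1 hz ?_
        have e : x z * (x i * v - w4) = c2 + a3 := by
          rw [mul_sub, ← hw']
          ring
        rw [e]
        exact add_mem (Ideal.mem_sup_left hc2) (Ideal.mem_sup_right ha3)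
      have h4 : x i * v ∈ c ⊔ b ^ n := by
        have h5 : c ⊔ a ^ (n + 1) ≤ c ⊔ b ^ n :=
          sup_le_sup le_rfl ((Ideal.pow_right_mono hab _).trans (Ideal.pow_le_pow_right n.le_succ))
        simpa using add_mem (h5 h3) (Ideal.mem_sup_right hw4 : w4 ∈ c ⊔ b ^ n)
      have h5 := ihn v h4
      refine add_mem (add_mem (Ideal.mem_sup_left hc') ?_) (Ideal.mem_sup_right ha2)
      obtain ⟨c6, hc6, b6, hb6, rfl⟩ := Submodule.mem_sup.1 h5
      rw [add_mul]
      refine add_mem (Ideal.mem_sup_left (Ideal.mul_mem_right _ _ hc6)) (Ideal.mem_sup_right ?_)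
      rw [pow_succ]
      exact Ideal.mul_mem_mul hb6 hzb

end

/-- The initial form of an element of `𝔪 \ 𝔪²` in the associated graded ring of a regular local
ring is a nonzerodivisor. -/
theorem mem_pow_of_mul_mem_pow_succ {B : Type u} [CommRing B] [IsRegularLocalRing B] {y : B}
    (hy : y ∈ maximalIdeal B) (hy' : y ∉ maximalIdeal B ^ 2) {n : ℕ} {s : B}
    (h : y * s ∈ maximalIdeal B ^ (n + 1)) : s ∈ maximalIdeal B ^ n := by
  classical
  obtain ⟨d, x, hx⟩ := exists_isRegularParameters B
  obtain ⟨i, hi⟩ := hx.exists_update hy hy'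
  set z := Function.update x i y with hz
  have hzi : z i = y := Function.update_self _ _ _
  set a := Ideal.span (z '' (Finset.univ.erase i : Finset (Fin d))) with ha
  have ham : a ≤ maximalIdeal B := hi.span_image_le _
  have hsplit : maximalIdeal B = Ideal.span {y} ⊔ a := by
    rw [← hi.span_eq, ← Set.image_univ, ← Finset.coe_univ,
      ← Finset.insert_erase (Finset.mem_univ i), Finset.coe_insert, Set.image_insert_eq,
      Ideal.span_insert, hzi]
  have hpow : ∀ n, maximalIdeal B ^ (n + 1) ≤
      Ideal.span {y} * maximalIdeal B ^ n ⊔ a ^ (n + 1) := by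
    intro n
    induction n with
    | zero => simp [← hsplit]
    | succ n ihn =>
      calc maximalIdeal B ^ (n + 1 + 1) = maximalIdeal B ^ (n + 1) * (Ideal.span {y} ⊔ a) := by
            rw [pow_succ, ← hsplit]
        _ ≤ _ := by
          rw [Ideal.mul_sup, mul_comm (maximalIdeal B ^ (n + 1)) (Ideal.span _)]
          refine sup_le le_sup_left ((Ideal.mul_mono_left ihn).trans ?_)
          rw [Ideal.sup_mul, ← pow_succ, mul_assoc]
          refine sup_le_sup (Ideal.mul_mono_right ?_) le_rfl
          rw [pow_succ]
          exact Ideal.mul_mono_right ham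
  obtain ⟨w, hw, e, he, hwe⟩ := Submodule.mem_sup.1 (hpow n h)
  obtain ⟨t, ht, rfl⟩ := Ideal.mem_span_singleton_mul.1 hw
  have h1 := hi.mem_of_mul_mem (Finset.univ.erase i) ∅ i (n + 1) (s - t)
    (Finset.disjoint_empty_left _) (Finset.notMem_empty _) (Finset.notMem_erase _ _) (by
      refine Ideal.mem_sup_right ?_
      rw [hzi, mul_sub, ← hwe, add_sub_cancel_left]
      exact he)
  simp only [Finset.coe_empty, Set.image_empty, Ideal.span_empty, bot_sup_eq] at h1
  have h2 := Ideal.pow_le_pow_right n.le_succ (Ideal.pow_right_mono ham _ h1)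
  simpa using add_mem h2 ht

/-! ### Families independent modulo `𝔪²`, and directed unions of regular local rings -/

/-- A family of elements of the maximal ideal `𝔪` of a local ring whose classes in `𝔪 / 𝔪²` are
linearly independent: no member is congruent modulo `𝔪²` to a combination of others. -/
def IsCotangentIndependent {L : Type*} [CommRing L] [IsLocalRing L] {ι : Type*} (g : ι → L) :
    Prop :=
  ∀ i, g i ∈ maximalIdeal L ∧
    ∀ C : Finset ι, i ∉ C → g i ∉ Ideal.span (g '' C) ⊔ maximalIdeal L ^ 2

theorem map_mk_mem_pow_iff {L : Type*} [CommRing L] [IsLocalRing L] (I : Ideal L)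
    [IsLocalRing (L ⧸ I)] {n : ℕ} {a : L} :
    Ideal.Quotient.mk I a ∈ maximalIdeal (L ⧸ I) ^ n ↔ a ∈ I ⊔ maximalIdeal L ^ n := by
  rw [← map_maximalIdeal_of_surjective (Ideal.Quotient.mk I) Ideal.Quotient.mk_surjective,
    ← Ideal.map_pow, ← Ideal.mem_comap,
    Ideal.comap_map_of_surjective' _ Ideal.Quotient.mk_surjective, Ideal.mk_ker, sup_comm]

theorem IsCotangentIndependent.isRegularLocalRing_quotient {B : Type u} [CommRing B]
    [IsRegularLocalRing B] {ι : Type*} {g : ι → B} (hg : IsCotangentIndependent g)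
    (C : Finset ι) : IsRegularLocalRing (B ⧸ Ideal.span (g '' C)) := by
  classical
  induction C using Finset.induction_on with
  | empty =>
    rw [Finset.coe_empty, Set.image_empty, Ideal.span_empty]
    exact IsRegularLocalRing.of_ringEquiv (RingEquiv.quotientBot B).symm
  | insert j C hj ih =>
    have hy : Ideal.Quotient.mk (Ideal.span (g '' C)) (g j) ∈ maximalIdeal _ := by
      rw [← pow_one (maximalIdeal _), map_mk_mem_pow_iff, pow_one]
      exact Ideal.mem_sup_right (hg j).1
    have hy' : Ideal.Quotient.mk (Ideal.span (g '' C)) (g j) ∉ maximalIdeal _ ^ 2 := by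
      rw [map_mk_mem_pow_iff]
      exact (hg j).2 C hj
    have h := isRegularLocalRing_quotient_span_singleton hy hy'
    rw [Finset.coe_insert, Set.image_insert_eq, Ideal.span_insert, sup_comm]
    rw [← Set.image_singleton, ← Ideal.map_span] at h
    exact IsRegularLocalRing.of_ringEquiv
      (DoubleQuot.quotQuotEquivQuotSup (Ideal.span (g '' C)) (Ideal.span {g j}))

/-- In a regular local ring, a member of a cotangent independent family acts injectively on the
associated graded ring of the quotient by other members. -/
theorem IsCotangentIndependent.mem_of_mul_mem {B : Type u} [CommRing B]
    [IsRegularLocalRing B] {ι : Type*} {g : ι → B} (hg : IsCotangentIndependent g)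
    {C : Finset ι} {i : ι} (hi : i ∉ C) {n : ℕ} {s : B}
    (h : g i * s ∈ Ideal.span (g '' C) ⊔ maximalIdeal B ^ (n + 1)) :
    s ∈ Ideal.span (g '' C) ⊔ maximalIdeal B ^ n := by
  have := hg.isRegularLocalRing_quotient C
  rw [← map_mk_mem_pow_iff] at h ⊢
  rw [map_mul] at h
  refine mem_pow_of_mul_mem_pow_succ ?_ ?_ h
  · rw [← pow_one (maximalIdeal _), map_mk_mem_pow_iff, pow_one]
    exact Ideal.mem_sup_right (hg i).1
  · rw [map_mk_mem_pow_iff]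
    exact (hg i).2 C hi

/-- A local ring is ind-regular if every finite set of its elements lies in a regular local subring
whose maximal ideal consists of nonunits of the whole ring. -/
def IsIndRegular (L : Type u) [CommRing L] : Prop :=
  ∀ F : Finset L, ∃ B : Subring L, (F : Set L) ⊆ B ∧ IsRegularLocalRing B ∧ IsLocalHom B.subtype

/-- Membership in a power of the maximal ideal is witnessed in all local subrings that contain a
suitable finite set. -/
theorem exists_finset_mem_pow {L : Type u} [CommRing L] [IsLocalRing L] (n : ℕ) :
    ∀ h ∈ maximalIdeal L ^ n, ∃ F : Finset L, ∀ (B : Subring L) [IsLocalRing B]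
      [IsLocalHom B.subtype], (F : Set L) ⊆ B → ∃ h' ∈ maximalIdeal B ^ n, (h' : L) = h := by
  classical
  induction n with
  | zero =>
    intro h _
    refine ⟨{h}, fun B _ _ hF => ⟨⟨h, hF (by simp)⟩, by simp, rfl⟩⟩
  | succ n ih =>
    intro h hh
    rw [pow_succ] at hh
    refine Submodule.mul_induction_on hh (fun a ha b hb => ?_) fun a b ⟨F, hF⟩ ⟨G, hG⟩ => ?_
    · obtain ⟨F, hF⟩ := ih a ha
      refine ⟨insert b F, fun B _ _ hB => ?_⟩
      rw [Finset.coe_insert, Set.insert_subset_iff] at hB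
      obtain ⟨a', ha', rfl⟩ := hF B hB.2
      refine ⟨a' * ⟨b, hB.1⟩, ?_, rfl⟩
      rw [pow_succ]
      refine Ideal.mul_mem_mul ha' ?_
      rw [← maximalIdeal_comap B.subtype]
      exact hb
    · refine ⟨F ∪ G, fun B _ _ hB => ?_⟩
      rw [Finset.coe_union, Set.union_subset_iff] at hB
      obtain ⟨a', ha', rfl⟩ := hF B hB.1
      obtain ⟨b', hb', rfl⟩ := hG B hB.2
      exact ⟨a' + b', add_mem ha' hb', rfl⟩

theorem map_subtype_pow_le {L : Type u} [CommRing L] [IsLocalRing L] (B : Subring L)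
    [IsLocalRing B] [IsLocalHom B.subtype] (n : ℕ) :
    (maximalIdeal B ^ n).map B.subtype ≤ maximalIdeal L ^ n := by
  rw [Ideal.map_pow]
  exact Ideal.pow_right_mono (map_maximalIdeal_le B.subtype) n

/-- The analogue of `IsCotangentIndependent.mem_of_mul_mem` in an ind-regular ring, for quotients by
arbitrarily many members of the family. A relation involves finitely many elements, and so holds
in a regular local subring. -/
theorem IsIndRegular.mem_of_mul_mem {L : Type u} [CommRing L] [IsLocalRing L] (hL : IsIndRegular L)
    {ι : Type*} {g : ι → L} (hg : IsCotangentIndependent g)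
    {C : Set ι} {i : ι} (hi : i ∉ C) {n : ℕ} {s : L}
    (h : g i * s ∈ Ideal.span (g '' C) ⊔ maximalIdeal L ^ (n + 1)) :
    s ∈ Ideal.span (g '' C) ⊔ maximalIdeal L ^ n := by
  classical
  obtain ⟨a, ha, b, hb, hab⟩ := Submodule.mem_sup.1 h
  obtain ⟨t, htC, c, rfl⟩ := (Submodule.mem_span_image_iff_exists_fun L).1 ha
  obtain ⟨F, hF⟩ := exists_finset_mem_pow (n + 1) b hb
  -- a regular local subring containing all elements that occur in the relation `h`
  obtain ⟨B, hFB, hreg, hloc⟩ := hL (insert s (insert (g i)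
    (F ∪ (t.image g ∪ Finset.univ.image c))))
  simp only [Finset.coe_insert, Finset.coe_union, Finset.coe_image, Set.insert_subset_iff,
    Set.union_subset_iff, Set.image_subset_iff] at hFB
  obtain ⟨hs, hgi, hFB, hgt, hct⟩ := hFB
  obtain ⟨b', hb', hbb⟩ := hF B hFB
  have hmem : ∀ j : {j // j = i ∨ j ∈ t}, g j ∈ B := by
    rintro ⟨j, rfl | hj⟩
    · exact hgi
    · exact hgt hj
  let gB : {j // j = i ∨ j ∈ t} → B := fun j => ⟨g j, hmem j⟩
  have hspan : ∀ (D : Finset {j // j = i ∨ j ∈ t}),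
      (Ideal.span (gB '' D)).map B.subtype = Ideal.span (g '' (D.image Subtype.val)) := by
    intro D
    rw [Ideal.map_span, ← Set.image_comp, Finset.coe_image, ← Set.image_comp]
    rfl
  have hgB : IsCotangentIndependent gB := by
    refine fun j => ⟨?_, fun D hj hD => (hg j).2 (D.image Subtype.val) (fun hm => ?_) ?_⟩
    · rw [← maximalIdeal_comap B.subtype]
      exact (hg j).1
    · obtain ⟨k, hk, hkj⟩ := Finset.mem_image.1 hm
      exact hj (Subtype.ext hkj ▸ hk)
    · have := Ideal.mem_map_of_mem B.subtype hD
      rw [Ideal.map_sup, hspan] at this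
      exact sup_le_sup le_rfl (map_subtype_pow_le B 2) this
  let i' : {j // j = i ∨ j ∈ t} := ⟨i, Or.inl rfl⟩
  let D : Finset {j // j = i ∨ j ∈ t} := t.attach.image fun j : {x // x ∈ t} => ⟨j.1, Or.inr j.2⟩
  have hD : D.image Subtype.val = t := by
    ext j
    simpa [D] using Or.inr
  have hiD : i' ∉ D := fun hmem => hi (htC (by
    rw [← hD]
    exact Finset.mem_image_of_mem Subtype.val hmem))
  have key : gB i' * ⟨s, hs⟩ ∈ Ideal.span (gB '' D) ⊔ maximalIdeal B ^ (n + 1) := by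
    have e : gB i' * ⟨s, hs⟩ = ∑ j : t, ⟨c j, hct (by simp)⟩ * gB ⟨j, Or.inr j.2⟩ + b' := by
      apply Subtype.ext
      simp only [Subring.coe_mul, Subring.coe_add, AddSubmonoidClass.coe_finsetSum, gB, hbb, i']
      exact hab.symm
    rw [e]
    refine add_mem (Ideal.mem_sup_left (sum_mem fun j _ => Ideal.mul_mem_left _ _
      (Ideal.subset_span (Set.mem_image_of_mem gB ?_)))) (Ideal.mem_sup_right hb')
    exact Finset.mem_coe.2 (Finset.mem_image_of_mem _ (Finset.mem_attach t j))
  have := Ideal.mem_map_of_mem B.subtype (hgB.mem_of_mul_mem hiD key)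
  rw [Ideal.map_sup, hspan, hD] at this
  exact sup_le_sup (Ideal.span_mono (Set.image_mono htC)) (map_subtype_pow_le B n) this

/-- A localization of a polynomial ring over `ℤ`, in any set of variables, at a prime ideal is
ind-regular: finitely many elements involve finitely many variables. -/
theorem isIndRegular_localization {σ : Type u} (q : Ideal (MvPolynomial σ ℤ)) [q.IsPrime] :
    IsIndRegular (Localization.AtPrime q) := by
  classical
  intro F
  have hfrac : ∀ l : Localization.AtPrime q, ∃ (a : MvPolynomial σ ℤ) (b : q.primeCompl),
      IsLocalization.mk' (Localization.AtPrime q) a b = l := fun l => by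
    obtain ⟨a, b, h⟩ := IsLocalization.exists_mk'_eq q.primeCompl l
    exact ⟨a, b, h⟩
  choose num den hnd using hfrac
  let T : Finset σ := F.biUnion fun l => (num l).vars ∪ (den l : MvPolynomial σ ℤ).vars
  let ρ : MvPolynomial {a // a ∈ T} ℤ →+* MvPolynomial σ ℤ :=
    (MvPolynomial.rename Subtype.val).toRingHom
  have hρ : Function.Injective ρ := MvPolynomial.rename_injective _ Subtype.val_injective
  have hlift : ∀ p : MvPolynomial σ ℤ, p.vars ⊆ T → ∃ p', ρ p' = p := fun p hp =>
    MvPolynomial.exists_rename_eq_of_vars_subset_range p Subtype.val Subtype.val_injective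
      (by simpa using hp)
  -- the localization of the polynomial ring in the variables `T` embeds, and is regular
  let φ := Localization.localRingHom (q.comap ρ) q ρ rfl
  have hφ : Function.Injective φ := by
    rw [injective_iff_map_eq_zero]
    intro l hl
    obtain ⟨a, b, rfl⟩ := IsLocalization.exists_mk'_eq (q.comap ρ).primeCompl l
    rw [Localization.localRingHom_mk', IsLocalization.mk'_eq_zero_iff] at hl
    obtain ⟨m, hm⟩ := hl
    have hm0 : (m : MvPolynomial σ ℤ) ≠ 0 := fun h => m.2 (h ▸ zero_mem q)
    have h0 : a = 0 := hρ (by rw [map_zero]; exact (mul_eq_zero.1 hm).resolve_left hm0)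
    rw [h0, IsLocalization.mk'_zero]
  have hbij : Function.Bijective φ.rangeRestrict :=
    ⟨fun a b h => hφ (congrArg Subtype.val h), φ.rangeRestrict_surjective⟩
  have hreg : IsRegularLocalRing φ.range :=
    IsRegularLocalRing.of_ringEquiv (RingEquiv.ofBijective φ.rangeRestrict hbij)
  refine ⟨φ.range, fun l hl => ?_, hreg, ⟨?_⟩⟩
  · have hT : (num l).vars ∪ (den l : MvPolynomial σ ℤ).vars ⊆ T :=
      Finset.subset_biUnion_of_mem (fun l => (num l).vars ∪ (den l : MvPolynomial σ ℤ).vars) hl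
    obtain ⟨a, ha⟩ := hlift (num l) (Finset.union_subset_left hT)
    obtain ⟨b, hb⟩ := hlift (den l) (Finset.union_subset_right hT)
    have hbq : b ∈ (q.comap ρ).primeCompl := fun h => (den l).2 (hb ▸ h)
    refine ⟨IsLocalization.mk' _ a (⟨b, hbq⟩ : (q.comap ρ).primeCompl), ?_⟩
    rw [Localization.localRingHom_mk', ← hnd l]
    congr 1
    exact Subtype.ext hb
  · rintro ⟨_, l, rfl⟩ hl
    have hu : IsUnit l :=
      (Localization.isLocalHom_localRingHom (q.comap ρ) q ρ rfl).map_nonunit l hl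
    exact hu.map φ.rangeRestrict

/-! ### Complete local rings -/

/-- Krull's intersection theorem: submodules of finite modules are closed. -/
theorem mem_of_forall_mem_sup_pow_smul {R : Type*} [CommRing R] [IsLocalRing R] [IsNoetherianRing R]
    {M : Type*} [AddCommGroup M] [Module R M] [Module.Finite R M] (N : Submodule R M) {v : M}
    (h : ∀ n, v ∈ N ⊔ maximalIdeal R ^ n • (⊤ : Submodule R M)) : v ∈ N := by
  rw [← Submodule.Quotient.mk_eq_zero]
  refine IsHausdorff.haus (inferInstance : IsHausdorff (maximalIdeal R) (M ⧸ N)) _ fun n => ?_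
  rw [SModEq.zero]
  have := Submodule.mem_map_of_mem (f := N.mkQ) (h n)
  rwa [Submodule.map_sup, Submodule.mkQ_map_self, bot_sup_eq, Submodule.map_smul'',
    Submodule.map_top, Submodule.range_mkQ] at this

theorem mem_smul_top_pi_iff {R : Type*} [CommRing R] {n : ℕ} (I : Ideal R) (v : Fin n → R) :
    v ∈ I • (⊤ : Submodule R (Fin n → R)) ↔ ∀ j, v j ∈ I := by
  classical
  constructor
  · intro hv
    refine Submodule.smul_induction_on hv (fun r hr w _ j => ?_) fun a b ha hb j => ?_
    · exact Ideal.mul_mem_right _ _ hr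
    · exact add_mem (ha j) (hb j)
  · intro hv
    rw [pi_eq_sum_univ v]
    exact sum_mem fun j _ => Submodule.smul_mem_smul (hv j) trivial

theorem isPrecomplete_pi {R : Type*} [CommRing R] (I : Ideal R) [IsPrecomplete I R] (n : ℕ) :
    IsPrecomplete I (Fin n → R) := by
  refine ⟨fun f hf => ?_⟩
  have h : ∀ j : Fin n, ∃ L : R, ∀ m, f m j ≡ L [SMOD (I ^ m • ⊤ : Submodule R R)] := fun j =>
    IsPrecomplete.prec inferInstance fun {a b} hab => by
      have := hf hab
      rw [SModEq.sub_mem, mem_smul_top_pi_iff] at this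
      rw [SModEq.sub_mem, smul_eq_mul, Ideal.mul_top]
      exact this j
  choose L hL using h
  refine ⟨L, fun m => ?_⟩
  rw [SModEq.sub_mem, mem_smul_top_pi_iff]
  intro j
  have := hL j m
  rwa [SModEq.sub_mem, smul_eq_mul, Ideal.mul_top] at this

/-- A form of Nakayama's lemma over a complete ring: no finiteness of `p` is assumed. -/
theorem le_of_le_sup_mul_of_isAdicComplete {S : Type*} [CommRing S] (m : Ideal S)
    [IsAdicComplete m S] {p N : Ideal S} (hN : N.FG) (hNp : N ≤ p) (h : p ≤ N ⊔ m * p) :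
    p ≤ N := by
  obtain ⟨k, g, hg⟩ := Submodule.fg_iff_exists_fin_generating_family.1 hN
  have hgp : ∀ i, g i ∈ p := fun i => hNp (hg ▸ Submodule.subset_span ⟨i, rfl⟩)
  let f : (Fin k → S) →ₗ[S] p := (Fintype.linearCombination S g).codRestrict p fun c => by
    rw [Fintype.linearCombination_apply]
    exact sum_mem fun i _ => p.smul_mem _ (hgp i)
  have hf : Set.range (p.subtype ∘ₗ f) = N := by
    rw [← LinearMap.coe_range, LinearMap.subtype_comp_codRestrict, Fintype.range_linearCombination,
      hg]
  have := isPrecomplete_pi m k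
  have hH : IsHausdorff m p := ⟨fun a ha => by
    apply Subtype.ext
    refine IsHausdorff.haus (inferInstance : IsHausdorff m S) _ fun n => ?_
    have := ha n
    rw [SModEq.zero] at this ⊢
    have h2 := Submodule.mem_map_of_mem (f := p.subtype) this
    rw [Submodule.map_smul''] at h2
    exact Submodule.smul_mono le_rfl le_top h2⟩
  have hsurj : Function.Surjective f := by
    refine surjective_of_mkQ_comp_surjective (I := m) fun y => ?_
    obtain ⟨⟨a, ha⟩, rfl⟩ := Submodule.mkQ_surjective _ y
    obtain ⟨b, hb, c, hc, rfl⟩ := Submodule.mem_sup.1 (h ha)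
    obtain ⟨v, hv⟩ : b ∈ Set.range (p.subtype ∘ₗ f) := hf ▸ hb
    refine ⟨v, ?_⟩
    rw [LinearMap.comp_apply, ← sub_eq_zero, ← map_sub, Submodule.mkQ_apply,
      Submodule.Quotient.mk_eq_zero, ← neg_mem_iff]
    have h1 : c ∈ Submodule.map p.subtype (m • ⊤) := by
      rwa [Submodule.map_smul'', Submodule.map_top, Submodule.range_subtype]
    obtain ⟨c', hc', rfl⟩ := h1
    have h2 : ((f v : p) : S) = b := hv
    have h3 : -(f v - ⟨b + p.subtype c', ha⟩) = c' := Subtype.ext (by simp [h2])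
    rw [h3]
    exact hc'
  intro a ha
  obtain ⟨v, hv⟩ := hsurj ⟨a, ha⟩
  have : a ∈ Set.range (p.subtype ∘ₗ f) := ⟨v, congrArg Subtype.val hv⟩
  rwa [hf] at this

/-- A complete local ring with finitely generated maximal ideal is noetherian. By Cohen's theorem
it suffices to treat primes; those containing the first `i` generators are handled by descending
induction on `i`. -/
theorem isNoetherianRing_of_isAdicComplete {S : Type*} [CommRing S] [IsLocalRing S]
    [IsAdicComplete (maximalIdeal S) S] {r : ℕ} (x : Fin r → S)
    (hx : Ideal.span (Set.range x) = maximalIdeal S) : IsNoetherianRing S := by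
  classical
  have key : ∀ k i : ℕ, i + k = r → ∀ p : Ideal S, p.IsPrime →
      (∀ j : Fin r, (j : ℕ) < i → x j ∈ p) → p.FG := by
    intro k
    induction k with
    | zero =>
      intro i hi p hp hxp
      have : p = maximalIdeal S := by
        refine le_antisymm (le_maximalIdeal hp.ne_top) (hx ▸ Ideal.span_le.2 ?_)
        rintro _ ⟨j, rfl⟩
        exact hxp j (by omega)
      rw [this, ← hx]
      exact ⟨Finset.univ.image x, by simp⟩
    | succ k ih =>
      intro i hi p hp hxp
      have hir : i < r := by omega
      by_cases hxi : x ⟨i, hir⟩ ∈ p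
      · refine ih (i + 1) (by omega) p hp fun j hj => ?_
        rcases Nat.lt_succ_iff_lt_or_eq.1 hj with hj | hj
        · exact hxp j hj
        · have : j = ⟨i, hir⟩ := Fin.ext hj
          exact this ▸ hxi
      · -- `p` is generated modulo `x i` by finitely many elements, and `p ∩ (x i) = x i * p`
        let A : Ideal S := Ideal.span (x '' {j | (j : ℕ) < i})
        let J : Ideal S := A ⊔ Ideal.span {x ⟨i, hir⟩}
        have hAp : A ≤ p := Ideal.span_le.2 (by rintro _ ⟨j, hj, rfl⟩; exact hxp j hj)
        have hnoeth : IsNoetherianRing (S ⧸ J) := by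
          refine IsNoetherianRing.of_prime fun P hP => ?_
          have hfg := ih (i + 1) (by omega) (P.comap (Ideal.Quotient.mk J)) (hP.comap _)
            fun j hj => by
              have hjJ : x j ∈ J := by
                rcases Nat.lt_succ_iff_lt_or_eq.1 hj with hj | hj
                · exact Ideal.mem_sup_left (Ideal.subset_span ⟨j, hj, rfl⟩)
                · have : j = ⟨i, hir⟩ := Fin.ext hj
                  exact this ▸ Ideal.mem_sup_right (Ideal.mem_span_singleton_self _)
              rw [Ideal.mem_comap, Ideal.Quotient.eq_zero_iff_mem.2 hjJ]
              exact zero_mem _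
          rw [← Ideal.map_comap_of_surjective _ Ideal.Quotient.mk_surjective P]
          exact Ideal.FG.map hfg _
        have hfg := (p.map (Ideal.Quotient.mk J)).fg_of_isNoetherianRing
        obtain ⟨G', hG', hspan⟩ := (Submodule.fg_span_iff_fg_span_finset_subset _).1 hfg
        obtain ⟨G, hG, rfl⟩ := Finset.subset_set_image_iff.1 hG'
        have hGp : Ideal.span (G : Set S) ≤ p := Ideal.span_le.2 hG
        let N : Ideal S := Ideal.span (G : Set S) ⊔ A
        have hNp : N ≤ p := sup_le hGp hAp
        have hNfg : N.FG := by
          refine Submodule.FG.sup ⟨G, rfl⟩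
            ⟨(Finset.univ.filter fun j : Fin r => (j : ℕ) < i).image x, ?_⟩
          simp [A, Ideal.span]
        have hle : p ≤ N ⊔ maximalIdeal S * p := by
          intro a ha
          have h1 : Ideal.Quotient.mk J a ∈ (Ideal.span (G : Set S)).map (Ideal.Quotient.mk J) := by
            rw [Ideal.map_span, ← Finset.coe_image]
            exact hspan.le (Ideal.mem_map_of_mem _ ha)
          rw [← Ideal.mem_comap, Ideal.comap_map_of_surjective' _ Ideal.Quotient.mk_surjective,
            Ideal.mk_ker, ← sup_assoc] at h1
          obtain ⟨c, hc, d, hd, rfl⟩ := Submodule.mem_sup.1 h1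
          obtain ⟨b, rfl⟩ := Ideal.mem_span_singleton'.1 hd
          refine add_mem (Ideal.mem_sup_left hc) (Ideal.mem_sup_right ?_)
          have hbx : b * x ⟨i, hir⟩ ∈ p := by simpa using sub_mem ha (hNp hc)
          have hxm : x ⟨i, hir⟩ ∈ maximalIdeal S := hx ▸ Ideal.subset_span ⟨_, rfl⟩
          rw [mul_comm]
          exact Ideal.mul_mem_mul ((hp.mem_or_mem hbx).resolve_right hxi) hxm
        have := le_of_le_sup_mul_of_isAdicComplete (maximalIdeal S) hNfg hNp hle
        exact le_antisymm this hNp ▸ hNfg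
  exact IsNoetherianRing.of_prime fun p hp => key r 0 (by omega) p hp fun j hj => by omega

/-! ### Completion at an ideal that is finitely generated modulo its square -/

section Completion

variable {L : Type u} [CommRing L] {M : Ideal L}

theorem pow_le_pow_sup_pow_succ {J : Ideal L} (hJM : J ≤ M) (hM : M ≤ J ⊔ M ^ 2) (n : ℕ) :
    M ^ n ≤ J ^ n ⊔ M ^ (n + 1) := by
  induction n with
  | zero => simp
  | succ n ih =>
    calc M ^ (n + 1) = M ^ n * M := pow_succ _ _
      _ ≤ (J ^ n ⊔ M ^ (n + 1)) * (J ⊔ M ^ 2) := Ideal.mul_mono ih hM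
      _ ≤ _ := by
        rw [Ideal.sup_mul, Ideal.mul_sup, ← pow_succ]
        refine sup_le (sup_le le_sup_left (le_sup_of_le_right ?_)) (le_sup_of_le_right ?_)
        · calc J ^ n * M ^ 2 ≤ M ^ n * M ^ 2 := Ideal.mul_mono_left (Ideal.pow_right_mono hJM n)
            _ = _ := by rw [← pow_add]
        · calc M ^ (n + 1) * (J ⊔ M ^ 2) ≤ M ^ (n + 1) * M := by
                refine Ideal.mul_mono_right (sup_le hJM ?_)
                exact Ideal.pow_le_self two_ne_zero
            _ = _ := by rw [← pow_succ]

theorem map_linearCombination_eq_sum {k : ℕ} (g : Fin k → L) (z : AdicCompletion M (Fin k → L)) :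
    AdicCompletion.map M (Fintype.linearCombination L g) z =
      ∑ i, algebraMap L (AdicCompletion M L) (g i) *
        AdicCompletion.map M (LinearMap.proj i) z := by
  induction z using AdicCompletion.induction_on with
  | h f =>
    ext n
    simp only [AdicCompletion.map_mk, AdicCompletion.mk_apply_coe,
      AdicCompletion.AdicCauchySequence.map_apply_coe, Submodule.mkQ_apply]
    rw [AdicCompletion.val_sum_apply]
    refine Eq.trans ?_ (Finset.sum_congr rfl fun i _ => AdicCompletion.val_mul M n _ _).symm
    change Ideal.Quotient.mk _ _ = ∑ i, Ideal.Quotient.mk _ (g i) * Ideal.Quotient.mk _ (f.1 n i)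
    rw [Fintype.linearCombination_apply, map_sum]
    exact Finset.sum_congr rfl fun i _ => by
      rw [← map_mul, mul_comm (g i)]
      rfl

/-- If `Mⁿ` is generated modulo `Mⁿ⁺¹` by a finitely generated ideal `K`, then `K` generates the
kernel of the projection of the `M`-adic completion to the ring modulo `Mⁿ`. The ideal `M` itself
need not be finitely generated. -/
theorem mem_map_of_val_eq_zero {n : ℕ} {K : Ideal L} (hK : K.FG) (hKM : K ≤ M ^ n)
    (hM : M ^ n ≤ K ⊔ M ^ (n + 1)) {s : AdicCompletion M L} (hs : s.val n = 0) :
    s ∈ K.map (algebraMap L (AdicCompletion M L)) := by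
  obtain ⟨k, g, hg⟩ := Submodule.fg_iff_exists_fin_generating_family.1 hK
  have hgK : ∀ i, g i ∈ K := fun i => hg ▸ Submodule.subset_span ⟨i, rfl⟩
  have htop : (M ^ n • ⊤ : Submodule L L) = M ^ n := by simp
  let f : (Fin k → L) →ₗ[L] (M ^ n • ⊤ : Submodule L L) :=
    (Fintype.linearCombination L g).codRestrict _ fun c => by
      rw [Fintype.linearCombination_apply, htop]
      exact sum_mem fun i _ => Ideal.mul_mem_left _ _ (hKM (hgK i))
  have hf : Set.range ((M ^ n • ⊤ : Submodule L L).subtype ∘ₗ f) = K := by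
    rw [← LinearMap.coe_range, LinearMap.subtype_comp_codRestrict, Fintype.range_linearCombination,
      hg]
  have hsurj : Function.Surjective (Submodule.mkQ (M • ⊤) ∘ₗ f) := fun y => by
    obtain ⟨⟨a, ha⟩, rfl⟩ := Submodule.mkQ_surjective _ y
    obtain ⟨b, hb, c, hc, rfl⟩ := Submodule.mem_sup.1 (hM (htop ▸ ha))
    obtain ⟨v, hv⟩ : b ∈ Set.range ((M ^ n • ⊤ : Submodule L L).subtype ∘ₗ f) := hf ▸ hb
    refine ⟨v, ?_⟩
    rw [LinearMap.comp_apply, ← sub_eq_zero, ← map_sub, Submodule.mkQ_apply,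
      Submodule.Quotient.mk_eq_zero, ← neg_mem_iff]
    have h1 : c ∈ Submodule.map (M ^ n • ⊤ : Submodule L L).subtype (M • ⊤) := by
      rw [Submodule.map_smul'', Submodule.map_top, Submodule.range_subtype, htop, smul_eq_mul,
        ← pow_succ']
      exact hc
    obtain ⟨c', hc', rfl⟩ := h1
    have h2 : ((f v : (M ^ n • ⊤ : Submodule L L)) : L) = b := hv
    have h3 : -(f v - ⟨b + (M ^ n • ⊤ : Submodule L L).subtype c', ha⟩) = c' :=
      Subtype.ext (by simp [h2])
    rw [h3]
    exact hc'
  obtain ⟨z, hz⟩ := AdicCompletion.map_surjective_of_mkQ_comp_surjective hsurj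
    (AdicCompletion.ofValEqZero M hs)
  have h1 : AdicCompletion.map M (Fintype.linearCombination L g) z = s := by
    rw [← AdicCompletion.ofPowSMul_ofValEqZero M hs, ← hz]
    change _ = AdicCompletion.map M _ (AdicCompletion.map M _ z)
    rw [← LinearMap.comp_apply, AdicCompletion.map_comp, LinearMap.subtype_comp_codRestrict]
  rw [← h1, map_linearCombination_eq_sum]
  exact sum_mem fun i _ => Ideal.mul_mem_right _ _ (Ideal.mem_map_of_mem _ (hgK i))

theorem val_eq_zero_of_mem_map {n : ℕ} {s : AdicCompletion M L}
    (hs : s ∈ (M ^ n).map (algebraMap L (AdicCompletion M L))) : s.val n = 0 := by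
  have htop : (M ^ n • ⊤ : Ideal L) = M ^ n := by simp
  refine Submodule.span_induction (p := fun s _ => s.val n = 0) ?_ rfl ?_ ?_ hs
  · rintro _ ⟨a, ha, rfl⟩
    exact (Submodule.Quotient.mk_eq_zero (M ^ n • ⊤ : Ideal L)).2 (htop.symm.le ha)
  · intro a b _ _ ha hb
    rw [AdicCompletion.val_add, Pi.add_apply, ha, hb, add_zero]
  · intro a b _ hb
    exact (congrArg (a.val n * ·) hb).trans (mul_zero _)

/-- The filtration of the completion by the kernels of the projections is the adic filtration of
the ideal generated by `J`. -/
theorem val_eq_zero_iff {J : Ideal L} (hJ : J.FG) (hJM : J ≤ M) (hM : M ≤ J ⊔ M ^ 2) (n : ℕ)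
    (s : AdicCompletion M L) :
    s.val n = 0 ↔ s ∈ J.map (algebraMap L (AdicCompletion M L)) ^ n := by
  rw [← Ideal.map_pow]
  refine ⟨fun hs => ?_, fun hs => ?_⟩
  · exact mem_map_of_val_eq_zero (Ideal.FG.pow hJ) (Ideal.pow_right_mono hJM n)
      (pow_le_pow_sup_pow_succ hJM hM n) hs
  · exact val_eq_zero_of_mem_map (Ideal.map_mono (Ideal.pow_right_mono hJM n) hs)

/-- The completion at an ideal `M` that is finitely generated modulo `M²`, by `J` say, is complete
at the ideal generated by `J`. -/
theorem isAdicComplete_adicCompletion {J : Ideal L} (hJ : J.FG) (hJM : J ≤ M)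
    (hM : M ≤ J ⊔ M ^ 2) :
    IsAdicComplete (J.map (algebraMap L (AdicCompletion M L))) (AdicCompletion M L) where
  haus' x hx := by
    ext n
    have := hx n
    rw [SModEq.zero, smul_eq_mul, Ideal.mul_top, ← val_eq_zero_iff hJ hJM hM] at this
    rw [this]
    rfl
  prec' x hx := by
    have hx' : ∀ {m n : ℕ}, m ≤ n → (x m).val m = (x n).val m := fun {m n} h => by
      have := hx h
      rw [SModEq.sub_mem, smul_eq_mul, Ideal.mul_top, ← val_eq_zero_iff hJ hJM hM] at this
      exact sub_eq_zero.1 this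
    let y : AdicCompletion M L :=
      ⟨fun i => (x i).val i, fun {m n} h => ((x n).property h).trans (hx' h).symm⟩
    refine ⟨y, fun i => ?_⟩
    rw [SModEq.sub_mem, smul_eq_mul, Ideal.mul_top, ← val_eq_zero_iff hJ hJM hM]
    exact sub_self _

theorem map_eq_ker_evalOne {J : Ideal L} (hJ : J.FG) (hJM : J ≤ M)
    (hM : M ≤ J ⊔ M ^ 2) : J.map (algebraMap L (AdicCompletion M L)) =
      RingHom.ker (AdicCompletion.evalOneₐ M).toRingHom := by
  ext s
  rw [← pow_one (J.map _), ← val_eq_zero_iff hJ hJM hM]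
  have eq : M ^ 1 * ⊤ = M := by simp
  have hinj : Function.Injective (Ideal.Quotient.factor (le_of_eq eq)) := by
    simpa [RingHom.injective_iff_ker_eq_bot, Ideal.Quotient.factor_ker]
      using Ideal.map_mk_eq_bot_of_le (le_of_eq eq.symm)
  simp [← AdicCompletion.factorₐ_evalₐ_one, ← AdicCompletion.factor_eval_eq_evalₐ]
  exact (map_eq_zero_iff _ hinj).symm

end Completion

/-- The completion of a local ring `(L, M)` at `M` is a regular local ring if `M` is generated
modulo `M²` by elements `x₁, …, xᵣ` such that each `xᵢ` acts injectively on the associated graded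
ring of `L / (x₁, …, xᵢ₋₁)`: the `xᵢ` become a regular sequence generating the maximal ideal. -/
theorem isRegularLocalRing_adicCompletion {L : Type u} [CommRing L] [IsLocalRing L] {r : ℕ}
    {x : Fin r → L} (hx : ∀ i, x i ∈ maximalIdeal L)
    (hM : maximalIdeal L ≤ Ideal.span (Set.range x) ⊔ maximalIdeal L ^ 2)
    (hreg : ∀ (i : Fin r) (n : ℕ) (s : L),
      x i * s ∈ Ideal.span (x '' Set.Iio i) ⊔ maximalIdeal L ^ (n + 1) →
      s ∈ Ideal.span (x '' Set.Iio i) ⊔ maximalIdeal L ^ n) :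
    IsRegularLocalRing (AdicCompletion (maximalIdeal L) L) := by
  set M := maximalIdeal L with hMdef
  set J : Ideal L := Ideal.span (Set.range x) with hJdef
  have hJ : J.FG := ⟨Set.Finite.toFinset (Set.finite_range x), by simp [hJdef, Ideal.span]⟩
  have hJM : J ≤ M := Ideal.span_le.2 (by rintro _ ⟨i, rfl⟩; exact hx i)
  set φ := algebraMap L (AdicCompletion M L) with hφ
  have hcomp := isAdicComplete_adicCompletion hJ hJM hM
  have hmax : (J.map φ).IsMaximal := by
    rw [map_eq_ker_evalOne hJ hJM hM]
    let _ := Ideal.Quotient.field M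
    exact RingHom.ker_isMaximal_of_surjective _ (AdicCompletion.evalOneₐ_surjective M)
  have hloc : IsLocalRing (AdicCompletion M L) := isLocalRing_of_isAdicComplete_maximal (J.map φ)
  have hmJ : J.map φ = maximalIdeal (AdicCompletion M L) := IsLocalRing.eq_maximalIdeal hmax
  have hspan : Ideal.span (Set.range (φ ∘ x)) = maximalIdeal (AdicCompletion M L) := by
    rw [← hmJ, Ideal.map_span, Set.range_comp]
  have hcomp' : IsAdicComplete (maximalIdeal (AdicCompletion M L)) (AdicCompletion M L) :=
    hmJ ▸ hcomp
  have hnoeth : IsNoetherianRing (AdicCompletion M L) :=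
    isNoetherianRing_of_isAdicComplete (φ ∘ x) hspan
  have hval : ∀ (n : ℕ) (s : AdicCompletion M L),
      s.val n = 0 ↔ s ∈ maximalIdeal (AdicCompletion M L) ^ n := fun n s => by
    rw [val_eq_zero_iff hJ hJM hM, hmJ]
  have hlift : ∀ (n : ℕ) (s : AdicCompletion M L), ∃ a : L,
      s - φ a ∈ maximalIdeal (AdicCompletion M L) ^ n := fun n s => by
    obtain ⟨a, ha⟩ := Submodule.Quotient.mk_surjective _ (s.val n)
    refine ⟨a, (hval n _).1 ?_⟩
    exact sub_eq_zero.2 ha.symm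
  have hpow : ∀ (n : ℕ) (a : L), φ a ∈ maximalIdeal (AdicCompletion M L) ^ n ↔ a ∈ M ^ n := by
    intro n a
    rw [← hval]
    refine (Submodule.Quotient.mk_eq_zero (M ^ n • ⊤ : Ideal L)).trans ?_
    rw [smul_eq_mul, Ideal.mul_top]
    rfl
  -- ideals generated by elements of `L` contract back to `L` up to powers of `M`
  have hcontr : ∀ (A : Ideal L) (k : ℕ) (b : L),
      φ b ∈ A.map φ ⊔ maximalIdeal (AdicCompletion M L) ^ k → b ∈ A ⊔ M ^ k := by
    intro A k b hb
    let e : AdicCompletion M L →+* L ⧸ M ^ k := (AdicCompletion.evalₐ M k).toRingHom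
    have he : e.comp φ = Ideal.Quotient.mk (M ^ k) :=
      RingHom.ext fun a => AdicCompletion.evalₐ_of M k a
    have h1 := Ideal.mem_map_of_mem e hb
    rw [Ideal.map_sup, Ideal.map_map, he, ← hmJ, ← Ideal.map_pow, Ideal.map_map, he,
      Ideal.map_mk_eq_bot_of_le (Ideal.pow_right_mono hJM k), sup_bot_eq, ← RingHom.comp_apply, he,
      ← Ideal.mem_comap, Ideal.comap_map_of_surjective' _ Ideal.Quotient.mk_surjective,
      Ideal.mk_ker] at h1
    exact h1
  have hmul : ∀ (i : Fin r) (s : AdicCompletion M L),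
      (φ ∘ x) i * s ∈ Ideal.span ((φ ∘ x) '' Set.Iio i) →
      s ∈ Ideal.span ((φ ∘ x) '' Set.Iio i) := by
    intro i s hs
    rw [Set.image_comp, ← Ideal.map_span] at hs ⊢
    set A := Ideal.span (x '' Set.Iio i)
    refine mem_of_forall_mem_sup_pow_smul _ fun n => ?_
    rw [smul_eq_mul, Ideal.mul_top]
    obtain ⟨a, ha⟩ := hlift (n + 1) s
    have h1 : x i * a ∈ A ⊔ M ^ (n + 1) := by
      refine hcontr A (n + 1) _ ?_
      have e : φ (x i * a) = φ (x i) * s - φ (x i) * (s - φ a) := by rw [map_mul]; ring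
      rw [e]
      exact sub_mem (Ideal.mem_sup_left hs) (Ideal.mem_sup_right (Ideal.mul_mem_left _ _ ha))
    obtain ⟨b, hb, c, hc, hbc⟩ := Submodule.mem_sup.1 (hreg i n a h1)
    have e : s = φ b + (φ c + (s - φ a)) := by rw [← hbc, map_add]; ring
    rw [e]
    exact add_mem (Ideal.mem_sup_left (Ideal.mem_map_of_mem φ hb)) (Ideal.mem_sup_right
      (add_mem ((hpow n c).2 hc) (Ideal.pow_le_pow_right n.le_succ ha)))
  have htake : ∀ i : ℕ, Ideal.ofList ((List.ofFn (φ ∘ x)).take i) =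
      Ideal.span ((φ ∘ x) '' {j | (j : ℕ) < i}) := by
    intro i
    refine congrArg Ideal.span (Set.ext fun a => ?_)
    change a ∈ (List.ofFn (φ ∘ x)).take i ↔ ∃ j : Fin r, (j : ℕ) < i ∧ (φ ∘ x) j = a
    simp only [List.mem_take_iff_getElem, List.length_ofFn, List.getElem_ofFn]
    constructor
    · rintro ⟨j, hj, rfl⟩
      exact ⟨⟨j, by omega⟩, by simp only; omega, rfl⟩
    · rintro ⟨j, hj, rfl⟩
      exact ⟨j, by omega, rfl⟩
  have hofList : Ideal.ofList (List.ofFn (φ ∘ x)) = maximalIdeal (AdicCompletion M L) := by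
    rw [← hspan]
    exact congrArg Ideal.span (Set.ext fun a => List.mem_ofFn)
  have hseq : RingTheory.Sequence.IsRegular (AdicCompletion M L) (List.ofFn (φ ∘ x)) := by
    refine ⟨⟨fun i hi => ?_⟩, ?_⟩
    · rw [List.length_ofFn] at hi
      rw [isSMulRegular_quotient_iff_mem_of_smul_mem, htake, smul_eq_mul, Ideal.mul_top,
        List.getElem_ofFn]
      exact hmul ⟨i, hi⟩
    · rw [hofList, smul_eq_mul, Ideal.mul_top]
      exact (maximalIdeal.isMaximal _).ne_top.symm
  have hdim := ringKrullDim_add_length_eq_ringKrullDim_of_isRegular _ hseq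
  have hdim0 : ringKrullDim (AdicCompletion M L ⧸ Ideal.ofList (List.ofFn (φ ∘ x))) = 0 := by
    rw [hofList]
    let _ := Ideal.Quotient.field (maximalIdeal (AdicCompletion M L))
    exact ringKrullDim_eq_zero_of_field _
  rw [hdim0, zero_add, List.length_ofFn] at hdim
  exact IsRegularParameters.isRegularLocalRing (x := φ ∘ x)
    ⟨hspan, by rw [← hdim, Fintype.card_fin]⟩

/-! ### Complete local rings are quotients of regular local rings -/

/-- Linear dependence in the cotangent space is dependence modulo `𝔪²`. -/
theorem toCotangent_mem_span_iff {L : Type*} [CommRing L] [IsLocalRing L]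
    (C : Set (maximalIdeal L)) (a : maximalIdeal L) :
    (maximalIdeal L).toCotangent a ∈
        Submodule.span (ResidueField L) ((maximalIdeal L).toCotangent '' C) ↔
      (a : L) ∈ Ideal.span ((fun c : maximalIdeal L => (c : L)) '' C) ⊔ maximalIdeal L ^ 2 := by
  have h1 : (maximalIdeal L).toCotangent a ∈
        Submodule.span (ResidueField L) ((maximalIdeal L).toCotangent '' C) ↔
      (maximalIdeal L).toCotangent a ∈ Submodule.span L ((maximalIdeal L).toCotangent '' C) := by
    rw [← Submodule.restrictScalars_span L (ResidueField L) Ideal.Quotient.mk_surjective]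
    rfl
  rw [h1, ← Submodule.map_span, ← Submodule.mem_comap, Submodule.comap_map_eq]
  have h2 : (Submodule.span L C ⊔ LinearMap.ker (maximalIdeal L).toCotangent).map
      (maximalIdeal L).subtype =
      Ideal.span ((fun c : maximalIdeal L => (c : L)) '' C) ⊔ maximalIdeal L ^ 2 := by
    rw [Submodule.map_sup, Ideal.map_toCotangent_ker, Submodule.map_span]
    rfl
  rw [← h2]
  constructor
  · intro h
    exact ⟨a, h, rfl⟩
  · rintro ⟨b, hb, hab⟩
    rwa [← Subtype.ext hab]

/-- Ring homomorphisms to a complete ring extend to the completion. -/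
theorem exists_extension_adicCompletion {L A : Type*} [CommRing L] [CommRing A] {M : Ideal L}
    {m : Ideal A} [IsAdicComplete m A] (π : L →+* A) (hπ : M ≤ m.comap π) :
    ∃ ψ : AdicCompletion M L →+* A, ψ.comp (algebraMap L (AdicCompletion M L)) = π := by
  have hle : ∀ n, M ^ n ≤ (m ^ n).comap π := fun n =>
    (Ideal.pow_right_mono hπ n).trans (Ideal.le_comap_pow π n)
  let f : ∀ n, AdicCompletion M L →+* A ⧸ m ^ n := fun n =>
    (Ideal.quotientMap (m ^ n) π (hle n)).comp (AdicCompletion.evalₐ M n).toRingHom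
  have hf : ∀ {i j : ℕ} (hij : i ≤ j), (Ideal.Quotient.factorPow m hij).comp (f j) = f i := by
    intro i j hij
    ext s
    induction s using AdicCompletion.induction_on with
    | h c =>
      have hj : f j (AdicCompletion.mk M L c) = Ideal.Quotient.mk _ (π (c.1 j)) := by
        change Ideal.quotientMap (m ^ j) π (hle j)
          (AdicCompletion.evalₐ M j (AdicCompletion.mk M L c)) = _
        rw [AdicCompletion.evalₐ_mk, Ideal.quotientMap_mk]
      have hi : f i (AdicCompletion.mk M L c) = Ideal.Quotient.mk _ (π (c.1 i)) := by
        change Ideal.quotientMap (m ^ i) π (hle i)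
          (AdicCompletion.evalₐ M i (AdicCompletion.mk M L c)) = _
        rw [AdicCompletion.evalₐ_mk, Ideal.quotientMap_mk]
      rw [RingHom.comp_apply, hj, hi]
      have := congrArg (Ideal.quotientMap (m ^ i) π (hle i)) (AdicCompletion.Ideal.mk_eq_mk M hij c)
      rw [Ideal.quotientMap_mk, Ideal.quotientMap_mk] at this
      exact this
  refine ⟨IsAdicComplete.liftRingHom m f hf, RingHom.ext fun a => ?_⟩
  refine IsHausdorff.eq_iff_smodEq (I := m) |>.2 fun n => ?_
  rw [SModEq.sub_mem, smul_eq_mul, Ideal.mul_top, ← Ideal.Quotient.mk_eq_mk_iff_sub_mem]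
  rw [RingHom.comp_apply, IsAdicComplete.mk_liftRingHom]
  change Ideal.quotientMap (m ^ n) π (hle n)
    (AdicCompletion.evalₐ M n (AdicCompletion.of M L a)) = _
  rw [AdicCompletion.evalₐ_of, Ideal.quotientMap_mk]

/-- A complete local ring `A` with finitely generated maximal ideal that is the image of an
ind-regular local ring `L` is the image of a regular local ring. If `K` is the kernel of `L → A`,
choose elements `b₁` of `K` that form a basis of the image of `K` in `𝔪 / 𝔪²`, and complete
`L / (b₁)`. -/
theorem exists_regular_surjection_of_isIndRegular {L A : Type u} [CommRing L] [IsLocalRing L]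
    (hL : IsIndRegular L) [CommRing A] [IsLocalRing A] (hA : (maximalIdeal A).FG)
    [IsAdicComplete (maximalIdeal A) A] (π : L →+* A) [IsLocalHom π]
    (hπ : Function.Surjective π) :
    ∃ (S : Type u) (_ : CommRing S) (_ : IsRegularLocalRing S) (ψ : S →+* A),
      Function.Surjective ψ := by
  classical
  let τ := (maximalIdeal L).toCotangent
  have hcomap : (maximalIdeal A).comap π = maximalIdeal L := maximalIdeal_comap π
  obtain ⟨k, y, hy⟩ := Submodule.fg_iff_exists_fin_generating_family.1 hA
  have hym : ∀ i, y i ∈ maximalIdeal A := fun i => hy ▸ Submodule.subset_span ⟨i, rfl⟩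
  choose z hz using fun i => hπ (y i)
  have hzm : ∀ i, z i ∈ maximalIdeal L := fun i => by
    rw [← hcomap, Ideal.mem_comap, hz]
    exact hym i
  -- `b₁ ⊆ K` becomes a basis of the image of `K` in the cotangent space; the finite set `Y` of
  -- lifts of generators of `maximalIdeal A` suffices to extend it to a basis `b₂` of the whole
  let Y : Set (maximalIdeal L) := Set.range fun i => ⟨z i, hzm i⟩
  let K : Set (maximalIdeal L) := {a | π a = 0}
  obtain ⟨b₁, hb₁K, -, hKb₁, hb₁⟩ := exists_linearIndepOn_extension (K := ResidueField L)
    (v := τ) (linearIndepOn_empty _ _) (Set.empty_subset K)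
  obtain ⟨b₂, hb₂t, hb₁₂, htb₂, hb₂⟩ := exists_linearIndepOn_extension hb₁
    (Set.subset_union_left (t := Y))
  let g : b₂ → L := fun v => (v.1 : L)
  have himage : ∀ C : Set b₂, g '' C = (fun c : maximalIdeal L => (c : L)) '' (Subtype.val '' C) :=
    fun C => by rw [← Set.image_comp]; rfl
  have hg : IsCotangentIndependent g := by
    refine fun i => ⟨i.1.2, fun C hi h => ?_⟩
    rw [himage, ← toCotangent_mem_span_iff, ← Set.image_comp] at h
    exact LinearIndependent.notMem_span_image (hb₂ : LinearIndependent _ fun v : b₂ => τ v)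
      (s := C) (x := i) (by simpa using hi) h
  let D : Set b₂ := {v | v.1 ∈ b₁}
  have hDfin : Finite (Dᶜ : Set b₂) := by
    have hY : Y.Finite := Set.finite_range _
    refine Set.Finite.to_subtype (Set.Finite.of_finite_image (f := Subtype.val)
      (hY.subset ?_) Subtype.val_injective.injOn)
    rintro _ ⟨v, hv, rfl⟩
    exact (hb₂t v.2).resolve_left hv
  obtain ⟨r, ⟨e⟩⟩ := Finite.exists_equiv_fin (Dᶜ : Set b₂)
  let x : Fin r → L := fun i => g (e.symm i).1
  let J : Ideal L := Ideal.span (g '' D)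
  have hJπ : ∀ a ∈ J, π a = 0 := by
    intro a ha
    have : J ≤ RingHom.ker π := Ideal.span_le.2 (by rintro _ ⟨v, hv, rfl⟩; exact hb₁K hv)
    exact this ha
  have hJm : J ≤ maximalIdeal L := fun a ha => by
    rw [← hcomap, Ideal.mem_comap, hJπ a ha]
    exact zero_mem _
  have hgspan : maximalIdeal L ≤ J ⊔ Ideal.span (Set.range x) ⊔ maximalIdeal L ^ 2 := by
    have hrange : Ideal.span (Set.range g) ≤ J ⊔ Ideal.span (Set.range x) := by
      refine Ideal.span_le.2 ?_
      rintro _ ⟨v, rfl⟩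
      by_cases hv : v ∈ D
      · exact Ideal.mem_sup_left (Ideal.subset_span ⟨v, hv, rfl⟩)
      · exact Ideal.mem_sup_right (Ideal.subset_span ⟨e ⟨v, hv⟩, by simp [x]⟩)
    refine le_trans ?_ (sup_le_sup_right hrange _)
    have hrg : Set.range g = (fun c : maximalIdeal L => (c : L)) '' b₂ := by
      rw [← Set.image_univ, himage, Set.image_univ, Subtype.range_coe]
    have hin : ∀ a : maximalIdeal L, τ a ∈ Submodule.span (ResidueField L) (τ '' b₂) →
        (a : L) ∈ Ideal.span (Set.range g) ⊔ maximalIdeal L ^ 2 := fun a ha => by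
      rw [hrg]
      exact (toCotangent_mem_span_iff _ _).1 ha
    intro a ha
    have h1 : π a ∈ Submodule.span A (Set.range y) := by
      rw [hy]
      rwa [← hcomap] at ha
    obtain ⟨c, hc⟩ := (Submodule.mem_span_range_iff_exists_fun A).1 h1
    choose c' hc' using fun i => hπ (c i)
    have h2 : a - ∑ i, c' i * z i ∈ maximalIdeal L :=
      sub_mem ha (sum_mem fun i _ => Ideal.mul_mem_left _ _ (hzm i))
    have h3 : π (a - ∑ i, c' i * z i) = 0 := by
      rw [map_sub, map_sum, ← hc, sub_eq_zero]
      exact Finset.sum_congr rfl fun i _ => by rw [map_mul, hc', hz, smul_eq_mul]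
    have h4 := hin ⟨_, h2⟩ (Submodule.span_mono (Set.image_mono hb₁₂) (hKb₁ ⟨⟨_, h2⟩, h3, rfl⟩))
    have h5 : ∑ i, c' i * z i ∈ Ideal.span (Set.range g) ⊔ maximalIdeal L ^ 2 :=
      sum_mem fun i _ => Ideal.mul_mem_left _ _
        (hin ⟨z i, hzm i⟩ (htb₂ ⟨_, Or.inr ⟨i, rfl⟩, rfl⟩))
    simpa using add_mem h4 h5
  have hloc : IsLocalRing (L ⧸ J) := isLocalRing_quotient hJm
  have hmk : ∀ {a : L} {I : Ideal L}, Ideal.Quotient.mk J a ∈ I.map (Ideal.Quotient.mk J) ↔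
      a ∈ J ⊔ I := fun {a I} => by
    rw [← Ideal.mem_comap, Ideal.comap_map_of_surjective' _ Ideal.Quotient.mk_surjective,
      Ideal.mk_ker, sup_comm]
  have hmmap : (maximalIdeal L).map (Ideal.Quotient.mk J) = maximalIdeal (L ⧸ J) :=
    map_maximalIdeal_of_surjective _ Ideal.Quotient.mk_surjective
  have hreg : IsRegularLocalRing (AdicCompletion (maximalIdeal (L ⧸ J)) (L ⧸ J)) := by
    refine isRegularLocalRing_adicCompletion (x := Ideal.Quotient.mk J ∘ x) (fun i => ?_) ?_ ?_
    · rw [← hmmap]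
      exact Ideal.mem_map_of_mem _ (hg _).1
    · rw [Set.range_comp, ← Ideal.map_span, ← hmmap, ← Ideal.map_pow, ← Ideal.map_sup]
      refine Ideal.map_le_iff_le_comap.2 fun a ha => ?_
      rw [Ideal.mem_comap, hmk, ← sup_assoc]
      exact hgspan ha
    · intro i n s hs
      obtain ⟨s, rfl⟩ := Ideal.Quotient.mk_surjective s
      rw [Set.image_comp, ← Ideal.map_span, ← hmmap, ← Ideal.map_pow, ← Ideal.map_sup] at hs ⊢
      rw [Function.comp_apply, ← map_mul, hmk] at hs
      rw [hmk]
      let C : Set b₂ := D ∪ (fun j => (e.symm j).1) '' Set.Iio i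
      have hC : ∀ n : ℕ, J ⊔ (Ideal.span (x '' Set.Iio i) ⊔ maximalIdeal L ^ n) =
          Ideal.span (g '' C) ⊔ maximalIdeal L ^ n := fun n => by
        rw [← sup_assoc, Set.image_union, Ideal.span_union, ← Set.image_comp]
        rfl
      rw [hC] at hs ⊢
      refine hL.mem_of_mul_mem hg (i := (e.symm i).1) ?_ hs
      rintro (h | ⟨j, hj, hji⟩)
      · exact (e.symm i).2 h
      · exact (ne_of_lt hj) (e.symm.injective (Subtype.ext hji))
  obtain ⟨ψ, hψ⟩ := exists_extension_adicCompletion (M := maximalIdeal (L ⧸ J))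
    (m := maximalIdeal A) (Ideal.Quotient.lift J π hJπ) (by
      rw [← hmmap]
      refine Ideal.map_le_iff_le_comap.2 fun a ha => ?_
      rw [Ideal.mem_comap, Ideal.mem_comap, Ideal.Quotient.lift_mk, ← Ideal.mem_comap, hcomap]
      exact ha)
  refine ⟨_, inferInstance, hreg, ψ, fun a => ?_⟩
  obtain ⟨l, rfl⟩ := hπ a
  refine ⟨algebraMap _ _ (Ideal.Quotient.mk J l), ?_⟩
  rw [← RingHom.comp_apply, hψ, Ideal.Quotient.lift_mk]

/-- A complete local ring `A` with finitely generated maximal ideal is a quotient of a regular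
local ring: `A` is the image of a localization of a polynomial ring over `ℤ` with one variable for
each element of `A`. -/
theorem exists_regular_surjection (A : Type u) [CommRing A] [IsLocalRing A]
    (hA : (maximalIdeal A).FG) [IsAdicComplete (maximalIdeal A) A] :
    ∃ (S : Type u) (_ : CommRing S) (_ : IsRegularLocalRing S) (ψ : S →+* A),
      Function.Surjective ψ := by
  let ev : MvPolynomial A ℤ →+* A := MvPolynomial.eval₂Hom (Int.castRingHom A) id
  have hev : Function.Surjective ev := fun a => ⟨MvPolynomial.X a, by simp [ev]⟩
  let q := (maximalIdeal A).comap ev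
  have hunit : ∀ b : q.primeCompl, IsUnit (ev b) := fun b => by
    by_contra h
    exact b.2 ((mem_maximalIdeal _).2 h)
  let π : Localization.AtPrime q →+* A := IsLocalization.lift hunit
  have hlift : ∀ p, π (algebraMap _ (Localization.AtPrime q) p) = ev p := fun p =>
    IsLocalization.lift_eq hunit p
  have hπ : Function.Surjective π := fun a => by
    obtain ⟨p, rfl⟩ := hev a
    exact ⟨algebraMap _ _ p, hlift p⟩
  have hloc : IsLocalHom π := ⟨fun l hl => by
    obtain ⟨a, b, rfl⟩ := IsLocalization.exists_mk'_eq q.primeCompl l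
    rw [IsLocalization.AtPrime.isUnit_mk'_iff (Localization.AtPrime q) q]
    intro ha
    have h1 : π (IsLocalization.mk' (Localization.AtPrime q) a b) * ev b = ev a := by
      rw [← hlift b, ← map_mul, IsLocalization.mk'_spec, hlift]
    exact (mem_maximalIdeal _).1 ha (h1 ▸ hl.mul (hunit b))⟩
  exact exists_regular_surjection_of_isIndRegular (isIndRegular_localization q) hA π hπ

/-! ### Residue field summands of the second syzygy -/

/-- The residue field `k` is a direct summand of `Z` exactly when `Z` has an element killed by the
maximal ideal `𝔪` and lying outside `𝔪 Z`: such an element generates a copy of `k`, which a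
functional on the vector space `Z / 𝔪 Z` splits off. -/
theorem isIsoToDirectSummand_residueField_iff {A : Type u} [CommRing A] [IsLocalRing A]
    {Z : Type u} [AddCommGroup Z] [Module A Z] :
    IsIsoToDirectSummand A (ResidueField A) Z ↔
      ∃ z : Z, (∀ a ∈ maximalIdeal A, a • z = 0) ∧
        z ∉ maximalIdeal A • (⊤ : Submodule A Z) := by
  have hker : ∀ a ∈ maximalIdeal A, ∀ t : ResidueField A, a • t = 0 := fun a ha t => by
    rw [Algebra.smul_def]
    have : algebraMap A (ResidueField A) a = 0 := (residue_eq_zero_iff a).2 ha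
    rw [this, zero_mul]
  constructor
  · rintro ⟨P, Q, hPQ, ⟨f⟩⟩
    refine ⟨f 1, fun a ha => ?_, fun hz => ?_⟩
    · rw [← Submodule.coe_smul, ← map_smul, hker a ha, map_zero, Submodule.coe_zero]
    · let g : Z →ₗ[A] ResidueField A := f.symm.toLinearMap ∘ₗ P.projectionOnto Q hPQ
      have hg : ∀ z ∈ maximalIdeal A • (⊤ : Submodule A Z), g z = 0 := fun z hz => by
        refine Submodule.smul_induction_on hz (fun a ha y _ => ?_) (fun x y hx hy => ?_)
        · rw [map_smul, hker a ha]
        · rw [map_add, hx, hy, add_zero]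
      have h1 : g (f 1 : Z) = 1 := by
        simp [g, Submodule.projectionOnto_apply_left]
      exact one_ne_zero (h1.symm.trans (hg _ hz))
  · rintro ⟨z, hz, hz'⟩
    let _ : Module (ResidueField A) (Z ⧸ maximalIdeal A • (⊤ : Submodule A Z)) :=
      inferInstanceAs (Module (A ⧸ maximalIdeal A) (Z ⧸ maximalIdeal A • (⊤ : Submodule A Z)))
    have _ : IsScalarTower A (ResidueField A) (Z ⧸ maximalIdeal A • (⊤ : Submodule A Z)) :=
      inferInstanceAs (IsScalarTower A (A ⧸ maximalIdeal A)
        (Z ⧸ maximalIdeal A • (⊤ : Submodule A Z)))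
    have hne : (Submodule.Quotient.mk z : Z ⧸ maximalIdeal A • (⊤ : Submodule A Z)) ≠ 0 :=
      fun h => hz' ((Submodule.Quotient.mk_eq_zero _).1 h)
    obtain ⟨f, hf⟩ := not_forall.1
      ((Module.forall_dual_apply_eq_zero_iff (ResidueField A) _).not.2 hne)
    let h : Z →ₗ[A] ResidueField A :=
      ((f (Submodule.Quotient.mk z))⁻¹ • f).restrictScalars A ∘ₗ Submodule.mkQ _
    have hhz : h z = 1 := inv_mul_cancel₀ hf
    let j : ResidueField A →ₗ[A] Z :=
      Submodule.liftQ (maximalIdeal A) (LinearMap.toSpanSingleton A Z z) fun a ha => hz a ha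
    have hj : ∀ a : A, j (residue A a) = a • z := fun a => rfl
    have hhj : ∀ t, h (j t) = t := fun t => by
      obtain ⟨a, rfl⟩ := residue_surjective t
      rw [hj, map_smul, hhz, Algebra.smul_def, mul_one]
      rfl
    refine ⟨LinearMap.range j, LinearMap.ker h, ⟨?_, ?_⟩,
      ⟨LinearEquiv.ofInjective j (Function.LeftInverse.injective hhj)⟩⟩
    · rw [Submodule.disjoint_def]
      rintro _ ⟨t, rfl⟩ ht
      rw [LinearMap.mem_ker, hhj] at ht
      rw [ht, map_zero]
    · rw [codisjoint_iff, eq_top_iff]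
      intro y _
      refine Submodule.mem_sup.2 ⟨j (h y), ⟨_, rfl⟩, y - j (h y), ?_, by abel⟩
      rw [LinearMap.mem_ker, map_sub, hhj, sub_self]

/-- For a cover `φ` of the maximal ideal `𝔪` of `A` by a finite free module: some multiple `s e` by
a socle element `s` lies outside `𝔪 (ker φ)`. Such multiples automatically lie in `ker φ`, which is
a second syzygy of the residue field. -/
def HasSocleGenerator {A : Type u} [CommRing A] [IsLocalRing A] {n : ℕ}
    (φ : (Fin n → A) →ₗ[A] A) : Prop :=
  ∃ s : A, (∀ a ∈ maximalIdeal A, a * s = 0) ∧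
    ∃ e : Fin n → A, s • e ∉ maximalIdeal A • LinearMap.ker φ

/-- An element of `ker φ` killed by `𝔪` has its coordinates in the socle, so if it is outside
`𝔪 (ker φ)`, then so is one of its components `zᵢ eᵢ`. -/
theorem isIsoToDirectSummand_ker_iff {A : Type u} [CommRing A] [IsLocalRing A] {n : ℕ}
    {φ : (Fin n → A) →ₗ[A] A} (hφ : LinearMap.range φ = maximalIdeal A) :
    IsIsoToDirectSummand A (ResidueField A) (LinearMap.ker φ) ↔ HasSocleGenerator φ := by
  have hmem : ∀ z : LinearMap.ker φ, z ∈ maximalIdeal A • (⊤ : Submodule A (LinearMap.ker φ)) ↔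
      (z : Fin n → A) ∈ maximalIdeal A • LinearMap.ker φ := fun z => by
    have h : (maximalIdeal A • (⊤ : Submodule A (LinearMap.ker φ))).map
        (LinearMap.ker φ).subtype = maximalIdeal A • LinearMap.ker φ := by
      rw [Submodule.map_smul'', Submodule.map_top, Submodule.range_subtype]
    rw [← h]
    exact (Submodule.subtype_injective _).mem_set_image.symm
  rw [isIsoToDirectSummand_residueField_iff]
  constructor
  · rintro ⟨z, hz, hz'⟩
    rw [hmem] at hz'
    by_contra hs
    rw [HasSocleGenerator] at hs
    push Not at hs
    refine hz' ?_
    rw [pi_eq_sum_univ' (z : Fin n → A)]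
    refine Submodule.sum_mem _ fun i _ => hs _ (fun a ha => ?_) _
    exact congrFun (congrArg Subtype.val (hz a ha)) i
  · rintro ⟨s, hs, e, he⟩
    have hker : s • e ∈ LinearMap.ker φ := by
      rw [LinearMap.mem_ker, map_smul, smul_eq_mul, mul_comm]
      exact hs _ (hφ ▸ LinearMap.mem_range_self φ e)
    refine ⟨⟨s • e, hker⟩, fun a ha => Subtype.ext ?_, fun h => he ((hmem _).1 h)⟩
    change a • s • e = 0
    rw [smul_smul, hs a ha, zero_smul]

/-- The first differential of a minimal free resolution of the residue field is a cover of the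
maximal ideal, since minimality forces the free module in degree `0` to have rank one. -/
theorem MinimalFreeResolution.exists_cover {A : Type u} [CommRing A] [IsLocalRing A]
    (F : MinimalFreeResolution A (ResidueField A)) :
    ∃ φ : (Fin (F.rank 1) → A) →ₗ[A] A,
      LinearMap.range φ = maximalIdeal A ∧ LinearMap.ker φ = F.syzygySucc 1 := by
  classical
  have hmin : ∀ v, F.ε v = 0 → ∀ j, v j ∈ maximalIdeal A := fun v hv j => by
    obtain ⟨w, rfl⟩ := (F.exact_ε v).1 hv
    exact F.minimal 0 w j
  have hone : ∀ i, F.ε (Pi.single i 1) ≠ 0 := fun i h => by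
    have := hmin _ h i
    rw [Pi.single_eq_same] at this
    exact (mem_maximalIdeal _).1 this isUnit_one
  have hsub : Subsingleton (Fin (F.rank 0)) := ⟨fun i j => by
    by_contra hij
    obtain ⟨a, ha⟩ := residue_surjective (F.ε (Pi.single i 1))
    obtain ⟨b, hb⟩ := residue_surjective (F.ε (Pi.single j 1))
    have h0 : F.ε (b • Pi.single i 1 - a • Pi.single j 1) = 0 := by
      rw [map_sub, map_smul, map_smul, ← ha, ← hb, Algebra.smul_def, Algebra.smul_def]
      exact sub_eq_zero.2 (mul_comm _ _)
    have h1 := hmin _ h0 i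
    simp only [Pi.sub_apply, Pi.smul_apply, Pi.single_eq_same, Pi.single_eq_of_ne hij,
      smul_eq_mul, mul_one, mul_zero, sub_zero] at h1
    exact hone j (hb ▸ (residue_eq_zero_iff b).2 h1)⟩
  obtain ⟨i⟩ : Nonempty (Fin (F.rank 0)) := by
    by_contra h
    rw [not_nonempty_iff] at h
    obtain ⟨v, hv⟩ := F.surjective_ε 1
    rw [Subsingleton.elim v 0, map_zero] at hv
    exact zero_ne_one hv
  refine ⟨LinearMap.proj i ∘ₗ F.d 0, le_antisymm ?_ fun a ha => ?_, ?_⟩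
  · rintro _ ⟨v, rfl⟩
    exact F.minimal 0 v i
  · have h0 : F.ε (a • Pi.single i 1) = 0 := by
      rw [map_smul, Algebra.smul_def]
      exact mul_eq_zero_of_left ((residue_eq_zero_iff a).2 ha) _
    obtain ⟨v, hv⟩ := (F.exact_ε _).1 h0
    refine ⟨v, ?_⟩
    rw [LinearMap.comp_apply, hv]
    simp
  · rw [MinimalFreeResolution.syzygySucc, ← LinearMap.exact_iff.1 (F.exact_d 0)]
    ext v
    rw [LinearMap.mem_ker, LinearMap.mem_ker, LinearMap.comp_apply]
    refine ⟨fun h => funext fun j => ?_, fun h => by rw [h, map_zero]⟩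
    rw [Subsingleton.elim j i]
    exact h

theorem exists_lift_of_range_le {A : Type u} [CommRing A] {n p : ℕ}
    {φ : (Fin n → A) →ₗ[A] A} {ψ : (Fin p → A) →ₗ[A] A}
    (h : LinearMap.range φ ≤ LinearMap.range ψ) :
    ∃ f : (Fin n → A) →ₗ[A] (Fin p → A), ∀ v, ψ (f v) = φ v := by
  classical
  choose y hy using fun i => h (LinearMap.mem_range_self φ (Pi.single i 1))
  refine ⟨Fintype.linearCombination A y, fun v => ?_⟩
  conv_rhs => rw [pi_eq_sum_univ' v]
  rw [Fintype.linearCombination_apply, map_sum, map_sum]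
  simp only [map_smul, hy]

/-- Unless `A` is a field, whether a cover of the maximal ideal has a socle generator does not
depend on the cover. -/
theorem HasSocleGenerator.of_cover {A : Type u} [CommRing A] [IsLocalRing A] {n p : ℕ}
    {φ : (Fin n → A) →ₗ[A] A} {ψ : (Fin p → A) →ₗ[A] A} (hA : maximalIdeal A ≠ ⊥)
    (hφ : LinearMap.range φ = maximalIdeal A) (hψ : LinearMap.range ψ = maximalIdeal A)
    (h : HasSocleGenerator φ) : HasSocleGenerator ψ := by
  obtain ⟨s, hs, e, he⟩ := h
  obtain ⟨f, hf⟩ := exists_lift_of_range_le (hφ.trans hψ.symm).le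
  obtain ⟨g, hg⟩ := exists_lift_of_range_le (hψ.trans hφ.symm).le
  have hsm : s ∈ maximalIdeal A := by
    by_contra hu
    rw [mem_maximalIdeal, mem_nonunits_iff, not_not] at hu
    exact hA ((Submodule.eq_bot_iff _).2 fun a ha => hu.mul_left_eq_zero.1 (hs a ha))
  refine ⟨s, hs, f e, fun hfe => he ?_⟩
  have h1 : g (s • f e) ∈ maximalIdeal A • LinearMap.ker φ := by
    have := Submodule.mem_map_of_mem (f := g) hfe
    rw [Submodule.map_smul''] at this
    refine Submodule.smul_mono le_rfl (Submodule.map_le_iff_le_comap.2 fun v hv => ?_) this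
    exact LinearMap.mem_ker.2 ((hg v).trans hv)
  have h2 : s • (g (f e) - e) ∈ maximalIdeal A • LinearMap.ker φ := by
    refine Submodule.smul_mem_smul hsm ?_
    rw [LinearMap.mem_ker, map_sub, hg, hf, sub_self]
  have := Submodule.sub_mem _ h1 h2
  rwa [map_smul, ← smul_sub, sub_sub_cancel] at this

/-! ### Burch ideals -/

theorem mem_colon_maximalIdeal {S : Type u} [CommRing S] [IsLocalRing S] {I : Ideal S} {a : S} :
    a ∈ Submodule.colon I (maximalIdeal S : Set S) ↔ ∀ b ∈ maximalIdeal S, b * a ∈ I := by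
  rw [Submodule.mem_colon]
  simp only [SetLike.mem_coe, smul_eq_mul, mul_comm]

theorem isBurchIdeal_iff_exists {S : Type u} [CommRing S] [IsLocalRing S] {I : Ideal S} :
    IsBurchIdeal I ↔ ∃ y ∈ maximalIdeal S, ∃ a, (∀ b ∈ maximalIdeal S, b * a ∈ I) ∧
      y * a ∉ maximalIdeal S * I := by
  rw [IsBurchIdeal, Ne, ← not_iff_not, not_not]
  push Not
  constructor
  · intro h y hy a ha
    rw [h]
    exact Ideal.mul_mem_mul hy (mem_colon_maximalIdeal.2 ha)
  · intro h
    refine le_antisymm (Ideal.mul_mono_right fun a ha => mem_colon_maximalIdeal.2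
      fun b _ => I.mul_mem_left b ha) (Ideal.mul_le.2 fun y hy a ha => h y hy a
        (mem_colon_maximalIdeal.1 ha))

/-- The quotient by a Burch ideal `I ≠ 𝔪` has a socle generator. If `y a ∉ 𝔪 I` with `y ∈ 𝔪` and
`a ∈ I : 𝔪`, take for `s` the class of `a` and for `e` a preimage of the class of `y`: lifting
`s e ∈ 𝔪 (ker φ)` to `S` and applying the lift of `φ` would give `y a ∈ 𝔪 I`. -/
theorem IsBurchIdeal.hasSocleGenerator {S A : Type u} [CommRing S] [IsLocalRing S] [CommRing A]
    [IsLocalRing A] {π : S →+* A} (hπ : Function.Surjective π)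
    (hker : RingHom.ker π ≠ maximalIdeal S) (hI : IsBurchIdeal (RingHom.ker π)) {n : ℕ}
    {φ : (Fin n → A) →ₗ[A] A} (hφ : LinearMap.range φ = maximalIdeal A) :
    HasSocleGenerator φ := by
  classical
  have hloc : IsLocalHom π := hπ.isLocalHom
  have hm : ∀ a, π a ∈ maximalIdeal A ↔ a ∈ maximalIdeal S := fun a => by
    rw [mem_maximalIdeal, mem_maximalIdeal, mem_nonunits_iff, mem_nonunits_iff, isUnit_map_iff]
  obtain ⟨y, hy, a, ha, hya⟩ := isBurchIdeal_iff_exists.1 hI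
  have ham : a ∈ maximalIdeal S := by
    by_contra hu
    rw [mem_maximalIdeal, mem_nonunits_iff, not_not] at hu
    refine hker (le_antisymm (le_maximalIdeal (RingHom.ker_ne_top π)) fun b hb => ?_)
    exact (Ideal.mul_unit_mem_iff_mem _ hu).1 (ha b hb)
  obtain ⟨e, he⟩ : π y ∈ LinearMap.range φ := hφ ▸ (hm y).2 hy
  refine ⟨π a, fun c hc => ?_, e, fun hmem => hya ?_⟩
  · obtain ⟨b, rfl⟩ := hπ c
    rw [← map_mul]
    exact ha b ((hm b).1 hc)
  -- `φ` lifts to a map from a free `S`-module to `𝔪`, with values `x i` on the basis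
  choose x hx using fun i => hπ (φ (Pi.single i 1))
  have hxm : ∀ i, x i ∈ maximalIdeal S := fun i => by
    rw [← hm, hx, ← hφ]
    exact LinearMap.mem_range_self _ _
  have hφx : ∀ t : Fin n → S, π (∑ i, t i * x i) = φ (fun i => π (t i)) := fun t => by
    conv_rhs => rw [pi_eq_sum_univ' (fun i => π (t i))]
    simp only [map_sum, map_mul, map_smul, hx, smul_eq_mul]
  have hlift : ∀ v ∈ maximalIdeal A • LinearMap.ker φ, ∃ t : Fin n → S,
      (∀ i, π (t i) = v i) ∧ ∑ i, t i * x i ∈ maximalIdeal S * RingHom.ker π := fun v hv => by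
    refine Submodule.smul_induction_on hv (fun c hc z hz => ?_) ?_
    · obtain ⟨b, rfl⟩ := hπ c
      choose t ht using fun i => hπ (z i)
      refine ⟨fun i => b * t i, fun i => ?_, ?_⟩
      · rw [map_mul, ht]
        rfl
      · simp only [mul_assoc, ← Finset.mul_sum]
        refine Ideal.mul_mem_mul ((hm b).1 hc) ?_
        rw [RingHom.mem_ker, hφx, funext ht]
        exact hz
    · rintro v w ⟨t, ht, ht'⟩ ⟨r, hr, hr'⟩
      refine ⟨t + r, fun i => ?_, ?_⟩
      · rw [Pi.add_apply, map_add, ht, hr, Pi.add_apply]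
      · simp only [Pi.add_apply, add_mul, Finset.sum_add_distrib]
        exact Ideal.add_mem _ ht' hr'
  obtain ⟨t, ht, ht'⟩ := hlift _ hmem
  choose ε hε using fun i => hπ (e i)
  have h1 : ∑ i, (t i - a * ε i) * x i ∈ maximalIdeal S * RingHom.ker π := by
    refine Ideal.sum_mem _ fun i _ => ?_
    rw [mul_comm (t i - _)]
    refine Ideal.mul_mem_mul (hxm i) ?_
    rw [RingHom.mem_ker, map_sub, ht, map_mul, hε, Pi.smul_apply, smul_eq_mul, sub_self]
  have h2 : a * (∑ i, ε i * x i - y) ∈ maximalIdeal S * RingHom.ker π := by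
    refine Ideal.mul_mem_mul ham ?_
    rw [RingHom.mem_ker, map_sub, hφx, funext hε, he, sub_self]
  have h3 : y * a = ∑ i, t i * x i - ∑ i, (t i - a * ε i) * x i - a * (∑ i, ε i * x i - y) := by
    rw [← Finset.sum_sub_distrib, mul_sub, Finset.mul_sum, sub_sub_eq_add_sub,
      add_comm, add_sub_assoc, ← Finset.sum_sub_distrib, Finset.sum_eq_zero, add_zero, mul_comm]
    intro i _
    ring
  rw [h3]
  exact Ideal.sub_mem _ (Ideal.sub_mem _ ht' h1) h2

/-- A syzygy of a regular system of parameters with coordinates in `𝔪²` lies in `𝔪` times the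
module of syzygies: writing its coordinates in terms of the parameters with coefficients in `𝔪`,
it becomes an `𝔪`-combination of Koszul relations. -/
theorem IsRegularParameters.mem_smul_ker {B : Type u} [CommRing B] [IsLocalRing B]
    [IsNoetherianRing B] {d : ℕ} {x : Fin d → B} (hx : IsRegularParameters x) (T : Finset (Fin d)) :
    ∀ w : Fin d → B, (∀ i ∉ T, w i = 0) → (∀ i, w i ∈ maximalIdeal B ^ 2) →
      Fintype.linearCombination B x w = 0 →
      w ∈ maximalIdeal B • LinearMap.ker (Fintype.linearCombination B x) := by
  classical
  induction T using Finset.induction_on with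
  | empty =>
    intro w hw _ _
    rw [funext fun i => hw i (Finset.notMem_empty i)]
    exact Submodule.zero_mem _
  | insert i T hi ih =>
    intro w hw hw2 hsum
    have hsum' : w i * x i + ∑ j ∈ T, w j * x j = 0 := by
      rw [← Finset.sum_insert (f := fun j => w j * x j) hi]
      rw [Fintype.linearCombination_apply] at hsum
      rw [← hsum]
      refine Finset.sum_subset (Finset.subset_univ _) fun j _ hj => ?_
      rw [hw j hj, zero_mul]
    have hwi : w i ∈ Ideal.span (x '' T) := by
      refine hx.mem_span_image_of_mul_mem hi ?_
      rw [mul_comm, eq_neg_of_add_eq_zero_left hsum']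
      exact neg_mem (Ideal.sum_mem _ fun j hj =>
        Ideal.mul_mem_left _ _ (Ideal.subset_span ⟨j, hj, rfl⟩))
    obtain ⟨r, hr⟩ := (Submodule.mem_span_image_finset_iff_exists_fun' B).1 hwi
    simp only [smul_eq_mul] at hr
    have hrm : ∀ j ∈ T, r j ∈ maximalIdeal B := fun j hj => by
      by_contra hu
      rw [mem_maximalIdeal, mem_nonunits_iff, not_not] at hu
      refine hx.notMem j ((Ideal.unit_mul_mem_iff_mem _ hu).1 ?_)
      have : r j * x j = -(∑ l ∈ T.erase j, r l * x l) + w i := by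
        rw [← hr, ← Finset.add_sum_erase T _ hj]
        ring
      rw [this]
      refine Submodule.add_mem_sup (neg_mem (Ideal.sum_mem _ fun l hl => ?_)) (hw2 i)
      exact Ideal.mul_mem_left _ _ (Ideal.subset_span ⟨l, Finset.ne_of_mem_erase hl, rfl⟩)
    -- the Koszul relations between `x i` and the other parameters
    let κ : Fin d → Fin d → B := fun j => x j • Pi.single i 1 - x i • Pi.single j 1
    have hκ : ∀ j, Fintype.linearCombination B x (κ j) = 0 := fun j => by
      simp [κ, Fintype.linearCombination_apply_single, mul_comm]
    have hK : ∑ j ∈ T, r j • κ j ∈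
        maximalIdeal B • LinearMap.ker (Fintype.linearCombination B x) :=
      Submodule.sum_mem _ fun j hj => Submodule.smul_mem_smul (hrm j hj) (hκ j)
    have hcoord : ∀ l, (∑ j ∈ T, r j • κ j) l =
        (∑ j ∈ T, r j * x j) * (Pi.single i 1 : Fin d → B) l - if l ∈ T then r l * x i else 0 := by
      intro l
      simp only [Finset.sum_apply, κ, Pi.smul_apply, Pi.sub_apply, smul_eq_mul, mul_sub,
        Finset.sum_sub_distrib, Finset.sum_mul, mul_assoc]
      congr 1
      simp [Pi.single_apply]
    have hrest : w - ∑ j ∈ T, r j • κ j ∈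
        maximalIdeal B • LinearMap.ker (Fintype.linearCombination B x) := by
      refine ih _ (fun l hl => ?_) (fun l => ?_) ?_
      · rw [Pi.sub_apply, hcoord, hr, if_neg hl]
        by_cases hli : l = i
        · rw [hli, Pi.single_eq_same]
          ring
        · rw [Pi.single_eq_of_ne hli, hw l (by simp [hli, hl])]
          ring
      · rw [Pi.sub_apply, hcoord, hr]
        refine Ideal.sub_mem _ (hw2 l) (Ideal.sub_mem _ (Ideal.mul_mem_right _ _ (hw2 i)) ?_)
        split_ifs with hl
        · rw [pow_two]
          exact Ideal.mul_mem_mul (hrm l hl) (hx.mem i)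
        · exact Ideal.zero_mem _
      · rw [map_sub, hsum, map_sum, zero_sub, neg_eq_zero]
        refine Finset.sum_eq_zero fun j _ => ?_
        rw [map_smul, hκ, smul_zero]
    have := Submodule.add_mem _ hrest hK
    rwa [sub_add_cancel] at this

theorem range_linearCombination_eq {A : Type u} [CommRing A] {d : ℕ} (y : Fin d → A) :
    LinearMap.range (Fintype.linearCombination A y) = Ideal.span (Set.range y) :=
  Fintype.range_linearCombination A y

/-- The converse of `IsBurchIdeal.hasSocleGenerator` for an ideal `I ⊆ 𝔪²` of a regular local
ring. If `𝔪 (I : 𝔪) = 𝔪 I`, then `I : 𝔪 ⊆ 𝔪²`; a multiple `s e` with `s` in `I : 𝔪` then differs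
from an element of `𝔪` times the syzygies modulo `I` by a syzygy with coordinates in `𝔪²`. -/
theorem isBurchIdeal_of_ker_le_sq {S A : Type u} [CommRing S] [IsRegularLocalRing S]
    [CommRing A] [IsLocalRing A] {π : S →+* A} (hπ : Function.Surjective π)
    (hker : RingHom.ker π ≠ maximalIdeal S) (hsq : RingHom.ker π ≤ maximalIdeal S ^ 2) {n : ℕ}
    {φ : (Fin n → A) →ₗ[A] A} (hφ : LinearMap.range φ = maximalIdeal A)
    (h : HasSocleGenerator φ) : IsBurchIdeal (RingHom.ker π) := by
  classical
  have hloc : IsLocalHom π := hπ.isLocalHom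
  have hm : ∀ a, π a ∈ maximalIdeal A ↔ a ∈ maximalIdeal S := fun a => by
    rw [mem_maximalIdeal, mem_maximalIdeal, mem_nonunits_iff, mem_nonunits_iff, isUnit_map_iff]
  obtain ⟨d, x, hx⟩ := exists_isRegularParameters S
  have hmm : maximalIdeal A ≠ ⊥ := fun hbot => by
    refine hker (le_antisymm (le_maximalIdeal (RingHom.ker_ne_top π)) fun a ha => ?_)
    have := (hm a).2 ha
    rwa [hbot, Ideal.mem_bot] at this
  let Φ := Fintype.linearCombination S x
  let ψ := Fintype.linearCombination A (π ∘ x)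
  have hΦψ : ∀ v : Fin d → S, ψ (fun i => π (v i)) = π (Φ v) := fun v => by
    simp [Φ, ψ, Fintype.linearCombination_apply]
  have hΦm : ∀ v, Φ v ∈ maximalIdeal S := fun v => by
    rw [← hx.span_eq, ← range_linearCombination_eq]
    exact LinearMap.mem_range_self _ v
  have hψ : LinearMap.range ψ = maximalIdeal A := by
    rw [range_linearCombination_eq, Set.range_comp, ← Ideal.map_span, hx.span_eq]
    exact map_maximalIdeal_of_surjective _ hπ
  obtain ⟨s', hs', e', he'⟩ := h.of_cover hmm hφ hψ
  intro hI
  obtain ⟨s, rfl⟩ := hπ s'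
  choose e he using fun i => hπ (e' i)
  have hsI : s ∈ Submodule.colon (RingHom.ker π) (maximalIdeal S : Set S) :=
    mem_colon_maximalIdeal.2 fun b hb => by
      rw [RingHom.mem_ker, map_mul]
      exact hs' _ ((hm b).2 hb)
  have hs2 : s ∈ maximalIdeal S ^ 2 := by
    obtain ⟨i⟩ : Nonempty (Fin d) := by
      by_contra hd
      rw [not_nonempty_iff] at hd
      refine hmm ?_
      rw [← hψ, range_linearCombination_eq, Set.range_eq_empty, Ideal.span_empty]
    refine mem_pow_of_mul_mem_pow_succ (hx.mem i)
      (fun h2 => hx.notMem i (Ideal.mem_sup_right h2)) ?_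
    have h1 : x i * s ∈ maximalIdeal S * RingHom.ker π := hI ▸ Ideal.mul_mem_mul (hx.mem i) hsI
    rw [pow_succ']
    exact Ideal.mul_mono_right hsq h1
  -- as `ker π ⊆ 𝔪²`, elements of `ker π` are values of vectors with coordinates in `𝔪`
  have hlift : ∀ t ∈ maximalIdeal S * RingHom.ker π,
      ∃ ω ∈ maximalIdeal S • Submodule.comap Φ (RingHom.ker π),
        (∀ i, ω i ∈ maximalIdeal S ^ 2) ∧ Φ ω = t := by
    intro t ht
    refine Submodule.mul_induction_on ht (fun a ha b hb => ?_) ?_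
    · have hb2 := hsq hb
      rw [pow_two, ← smul_eq_mul] at hb2
      nth_rewrite 2 [← hx.span_eq] at hb2
      obtain ⟨β, hβ, hβb⟩ := (Submodule.mem_ideal_smul_span_iff_exists_sum _ _ _).1 hb2
      have hβΦ : Φ β = b := by
        rw [← hβb, Fintype.linearCombination_apply, Finsupp.sum_fintype _ _ (by simp)]
      refine ⟨a • β, Submodule.smul_mem_smul ha ?_, fun i => ?_, ?_⟩
      · rw [Submodule.mem_comap, hβΦ]
        exact hb
      · rw [pow_two]
        exact Ideal.mul_mem_mul ha (hβ i)
      · rw [map_smul, hβΦ, smul_eq_mul]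
    · rintro t r ⟨ω, h1, h2, rfl⟩ ⟨ω', h1', h2', rfl⟩
      exact ⟨ω + ω', add_mem h1 h1', fun i => add_mem (h2 i) (h2' i), map_add _ _ _⟩
  have hmap : ∀ v ∈ maximalIdeal S • Submodule.comap Φ (RingHom.ker π),
      (fun i => π (v i)) ∈ maximalIdeal A • LinearMap.ker ψ := fun v hv => by
    refine Submodule.smul_induction_on hv (fun a ha z hz => ?_) fun v w hv hw => ?_
    · have : (fun i => π ((a • z) i)) = π a • fun i => π (z i) := funext fun i => map_mul π _ _
      rw [this]
      refine Submodule.smul_mem_smul ((hm a).2 ha) ?_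
      rw [LinearMap.mem_ker, hΦψ]
      exact hz
    · have : (fun i => π ((v + w) i)) = (fun i => π (v i)) + fun i => π (w i) :=
        funext fun i => map_add π _ _
      rw [this]
      exact add_mem hv hw
  obtain ⟨ω, hω, hω2, hωt⟩ := hlift (s * Φ e) (by
    rw [hI, mul_comm s]
    exact Ideal.mul_mem_mul (hΦm e) hsI)
  have hw : s • e - ω ∈ maximalIdeal S • LinearMap.ker Φ := by
    refine hx.mem_smul_ker Finset.univ _ (fun i hi => absurd (Finset.mem_univ i) hi)
      (fun i => ?_) ?_
    · exact sub_mem (Ideal.mul_mem_right _ _ hs2) (hω2 i)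
    · change Φ _ = 0
      rw [map_sub, map_smul, hωt, smul_eq_mul, sub_self]
  have hse : s • e ∈ maximalIdeal S • Submodule.comap Φ (RingHom.ker π) := by
    rw [← sub_add_cancel (s • e) ω]
    refine add_mem (Submodule.smul_mono le_rfl (fun v hv => ?_) hw) hω
    rw [Submodule.mem_comap, LinearMap.mem_ker.1 hv]
    exact zero_mem _
  refine he' ?_
  convert hmap _ hse using 1
  funext i
  rw [Pi.smul_apply, Pi.smul_apply, smul_eq_mul, smul_eq_mul, map_mul, he]

/-- If the image of `I` modulo an ideal contained in `I` is a Burch ideal, then so is `I`. -/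
theorem isBurchIdeal_of_isBurchIdeal_map {S T : Type u} [CommRing S] [IsLocalRing S] [CommRing T]
    [IsLocalRing T] {q : S →+* T} (hq : Function.Surjective q) {I : Ideal S}
    (hqI : RingHom.ker q ≤ I) (h : IsBurchIdeal (I.map q)) : IsBurchIdeal I := by
  have hmap := map_maximalIdeal_of_surjective q hq
  intro hI
  refine h ?_
  have hcolon : Submodule.colon (I.map q) (maximalIdeal T : Set T) =
      (Submodule.colon I (maximalIdeal S : Set S)).map q := by
    refine le_antisymm (fun t ht => ?_) (Ideal.map_le_iff_le_comap.2 fun a ha => ?_)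
    · obtain ⟨a, rfl⟩ := hq t
      refine Ideal.mem_map_of_mem q (mem_colon_maximalIdeal.2 fun b hb => ?_)
      have := mem_colon_maximalIdeal.1 ht (q b) (hmap ▸ Ideal.mem_map_of_mem q hb)
      rw [← map_mul, ← Ideal.mem_comap, Ideal.comap_map_of_surjective' q hq,
        sup_eq_left.2 hqI] at this
      exact this
    · refine mem_colon_maximalIdeal.2 fun t ht => ?_
      rw [← hmap] at ht
      obtain ⟨b, hb, rfl⟩ := (Ideal.mem_map_iff_of_surjective q hq).1 ht
      rw [← map_mul]
      exact Ideal.mem_map_of_mem q (mem_colon_maximalIdeal.1 ha b hb)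
  rw [hcolon, ← hmap, ← Ideal.map_mul, ← Ideal.map_mul, hI]

/-- Induction on the dimension of `S`, killing an element of `ker π` outside `𝔪²` if there is
one. -/
theorem isBurchIdeal_of_spanFinrank_lt (N : ℕ) : ∀ {S A : Type u} [CommRing S]
    [IsRegularLocalRing S] [CommRing A] [IsLocalRing A] {π : S →+* A}
    (_ : (maximalIdeal S).spanFinrank < N) (_ : Function.Surjective π)
    (_ : RingHom.ker π ≠ maximalIdeal S) {n : ℕ} {φ : (Fin n → A) →ₗ[A] A}
    (_ : LinearMap.range φ = maximalIdeal A) (_ : HasSocleGenerator φ),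
    IsBurchIdeal (RingHom.ker π) := by
  induction N with
  | zero => exact fun h => absurd h (Nat.not_lt_zero _)
  | succ N ih =>
    intro S A _ _ _ _ π hN hπ hker n φ hφ h
    by_cases hsq : RingHom.ker π ≤ maximalIdeal S ^ 2
    · exact isBurchIdeal_of_ker_le_sq hπ hker hsq hφ h
    obtain ⟨x, hx, hx2⟩ := SetLike.not_le_iff_exists.1 hsq
    have hdom := isDomain_of_isRegularLocalRing S
    have hreg := isRegularLocalRing_quotient_span_singleton
      (le_maximalIdeal (RingHom.ker_ne_top π) hx) hx2
    have hdim : (maximalIdeal (S ⧸ Ideal.span {x})).spanFinrank + 1 ≤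
        (maximalIdeal S).spanFinrank := by
      have h1 := ringKrullDim_quotient_succ_le_of_nonZeroDivisor
        (mem_nonZeroDivisors_of_ne_zero (fun h0 : x = 0 => hx2 (h0 ▸ zero_mem _)))
      rw [← IsRegularLocalRing.spanFinrank_maximalIdeal,
        ← IsRegularLocalRing.spanFinrank_maximalIdeal] at h1
      exact_mod_cast h1
    have hxker : Ideal.span {x} ≤ RingHom.ker π := (Ideal.span_singleton_le_iff_mem _).2 hx
    let q := Ideal.Quotient.mk (Ideal.span {x})
    have hq : Function.Surjective q := Ideal.Quotient.mk_surjective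
    let π' : S ⧸ Ideal.span {x} →+* A := Ideal.Quotient.lift _ π hxker
    have hker' : RingHom.ker π' = (RingHom.ker π).map q := Ideal.ker_quotient_lift π hxker
    have hqker : RingHom.ker q ≤ RingHom.ker π := Ideal.mk_ker.trans_le hxker
    refine isBurchIdeal_of_isBurchIdeal_map hq hqker (hker' ▸ ih (by lia)
      (Ideal.Quotient.lift_surjective_of_surjective _ _ hπ) (fun he => hker ?_) hφ h)
    rw [hker', ← map_maximalIdeal_of_surjective q hq] at he
    have := congrArg (Ideal.comap q) he
    rwa [Ideal.comap_map_of_surjective' q hq, Ideal.comap_map_of_surjective' q hq,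
      sup_eq_left.2 hqker, sup_eq_left.2 (hqker.trans (le_maximalIdeal (RingHom.ker_ne_top π)))]
      at this

/-- Over a regular local ring, an ideal `I ≠ 𝔪` whose quotient has a socle generator is a Burch
ideal. -/
theorem HasSocleGenerator.isBurchIdeal {S A : Type u} [CommRing S] [IsRegularLocalRing S]
    [CommRing A] [IsLocalRing A] {π : S →+* A} (hπ : Function.Surjective π)
    (hker : RingHom.ker π ≠ maximalIdeal S) {n : ℕ} {φ : (Fin n → A) →ₗ[A] A}
    (hφ : LinearMap.range φ = maximalIdeal A) (h : HasSocleGenerator φ) :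
    IsBurchIdeal (RingHom.ker π) :=
  isBurchIdeal_of_spanFinrank_lt _ (Nat.lt_succ_self _) hπ hker hφ h

/-! ### Socle generators and completion -/

/-- A homomorphism of local rings that induces isomorphisms modulo all powers of the maximal
ideals, as the map to the completion does. -/
structure IsDenseLocalHom {R B : Type*} [CommRing R] [IsLocalRing R] [CommRing B] [IsLocalRing B]
    (σ : R →+* B) : Prop where
  map_eq : (maximalIdeal R).map σ = maximalIdeal B
  exists_sub_mem : ∀ (N : ℕ) (b : B), ∃ r, b - σ r ∈ maximalIdeal B ^ N
  mem_of_map_mem : ∀ (N : ℕ) (r : R), σ r ∈ maximalIdeal B ^ N → r ∈ maximalIdeal R ^ N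

theorem isDenseLocalHom_adicCompletion (R : Type u) [CommRing R] [IsLocalRing R]
    [IsNoetherianRing R] :
    IsDenseLocalHom (algebraMap R (AdicCompletion (maximalIdeal R) R)) := by
  have hval : ∀ (N : ℕ) (b : AdicCompletion (maximalIdeal R) R),
      b.val N = 0 ↔ b ∈ maximalIdeal (AdicCompletion (maximalIdeal R) R) ^ N := fun N b => by
    rw [AdicCompletion.maximalIdeal_eq_map]
    exact val_eq_zero_iff (maximalIdeal R).fg_of_isNoetherianRing le_rfl le_sup_left N b
  refine ⟨AdicCompletion.maximalIdeal_eq_map.symm, fun N b => ?_, fun N r hr => ?_⟩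
  · obtain ⟨r, hr⟩ := Submodule.mkQ_surjective _ (b.val N)
    refine ⟨r, (hval _ _).1 ?_⟩
    rw [AdicCompletion.val_sub_apply, sub_eq_zero, ← hr]
    rfl
  · have h : Submodule.mkQ (maximalIdeal R ^ N • ⊤ : Ideal R) r = 0 := (hval N _).2 hr
    rwa [Submodule.mkQ_apply, Submodule.Quotient.mk_eq_zero, smul_eq_mul, Ideal.mul_top] at h

section

variable {R B : Type u} [CommRing R] [IsLocalRing R] [CommRing B] [IsLocalRing B] {σ : R →+* B}
  {n : ℕ} {y : Fin n → R}

theorem IsDenseLocalHom.map_mem (hσ : IsDenseLocalHom σ) {N : ℕ} {r : R}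
    (hr : r ∈ maximalIdeal R ^ N) : σ r ∈ maximalIdeal B ^ N := by
  rw [← hσ.map_eq, ← Ideal.map_pow]
  exact Ideal.mem_map_of_mem σ hr

theorem linearCombination_map {R B : Type*} [CommRing R] [CommRing B] {σ : R →+* B} {n : ℕ}
    {y : Fin n → R} (v : Fin n → R) :
    Fintype.linearCombination B (σ ∘ y) (σ ∘ v) = σ (Fintype.linearCombination R y v) := by
  simp [Fintype.linearCombination_apply]

/-- Syzygies over `B` are approximated by syzygies over `R`: an approximation by a vector over `R`
is a syzygy up to an element of `𝔪ᴺ⁺¹`, which is the value of a vector with entries in `𝔪ᴺ`. -/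
theorem IsDenseLocalHom.exists_mem_ker (hσ : IsDenseLocalHom σ)
    (hy : Ideal.span (Set.range y) = maximalIdeal R) (N : ℕ) {v : Fin n → B}
    (hv : Fintype.linearCombination B (σ ∘ y) v = 0) :
    ∃ z : Fin n → R, Fintype.linearCombination R y z = 0 ∧
      ∀ i, v i - σ (z i) ∈ maximalIdeal B ^ N := by
  have hym : ∀ i, y i ∈ maximalIdeal R := fun i => hy ▸ Ideal.subset_span ⟨i, rfl⟩
  choose z hz using fun i => hσ.exists_sub_mem N (v i)
  have h1 : Fintype.linearCombination R y z ∈ maximalIdeal R ^ (N + 1) := by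
    refine hσ.mem_of_map_mem _ _ ?_
    rw [← linearCombination_map, ← sub_zero (Fintype.linearCombination B (σ ∘ y) (σ ∘ z)), ← hv,
      ← map_sub, Fintype.linearCombination_apply]
    refine Ideal.sum_mem _ fun i _ => ?_
    rw [pow_succ]
    refine Ideal.mul_mem_mul ?_ (hσ.map_eq ▸ Ideal.mem_map_of_mem σ (hym i))
    rw [← neg_mem_iff, Pi.sub_apply, neg_sub]
    exact hz i
  rw [pow_succ, ← smul_eq_mul, ← hy] at h1
  obtain ⟨c, hc, hc'⟩ := (Submodule.mem_ideal_smul_span_iff_exists_sum _ _ _).1 h1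
  rw [Finsupp.sum_fintype _ _ (by simp)] at hc'
  refine ⟨fun i => z i - c i, ?_, fun i => ?_⟩
  · have : Fintype.linearCombination R y c = Fintype.linearCombination R y z := hc'
    change Fintype.linearCombination R y (z - ⇑c) = 0
    rw [map_sub, this, sub_self]
  · rw [map_sub, ← sub_add]
    exact add_mem (hz i) (hσ.map_mem (hy ▸ hc i))

theorem IsDenseLocalHom.exists_mem_smul_ker (hσ : IsDenseLocalHom σ)
    (hy : Ideal.span (Set.range y) = maximalIdeal R) (N : ℕ) {v : Fin n → B}
    (hv : v ∈ maximalIdeal B • LinearMap.ker (Fintype.linearCombination B (σ ∘ y))) :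
    ∃ z ∈ maximalIdeal R • LinearMap.ker (Fintype.linearCombination R y),
      ∀ i, v i - σ (z i) ∈ maximalIdeal B ^ N := by
  refine Submodule.smul_induction_on hv (fun a ha w hw => ?_) ?_
  · obtain ⟨z, hz, hz'⟩ := hσ.exists_mem_ker hy N (LinearMap.mem_ker.1 hw)
    obtain ⟨r, hr⟩ := hσ.exists_sub_mem (N + 1) a
    have hrm : r ∈ maximalIdeal R := by
      rw [← pow_one (maximalIdeal R)]
      refine hσ.mem_of_map_mem 1 r ?_
      rw [pow_one, ← sub_sub_cancel a (σ r)]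
      exact sub_mem ha (Ideal.pow_le_self (Nat.succ_ne_zero N) hr)
    refine ⟨r • z, Submodule.smul_mem_smul hrm hz, fun i => ?_⟩
    have : (a • w) i - σ ((r • z) i) = a * (w i - σ (z i)) + (a - σ r) * σ (z i) := by
      rw [Pi.smul_apply, Pi.smul_apply, smul_eq_mul, smul_eq_mul, map_mul]
      ring
    rw [this]
    exact add_mem (Ideal.mul_mem_left _ _ (hz' i))
      (Ideal.mul_mem_right _ _ (Ideal.pow_le_pow_right (Nat.le_succ N) hr))
  · rintro v w ⟨z, hz, hz'⟩ ⟨t, ht, ht'⟩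
    refine ⟨z + t, add_mem hz ht, fun i => ?_⟩
    rw [Pi.add_apply, Pi.add_apply, map_add, add_sub_add_comm]
    exact add_mem (hz' i) (ht' i)

theorem IsDenseLocalHom.comp_mem_smul_ker (hσ : IsDenseLocalHom σ) {z : Fin n → R}
    (hz : z ∈ maximalIdeal R • LinearMap.ker (Fintype.linearCombination R y)) :
    σ ∘ z ∈ maximalIdeal B • LinearMap.ker (Fintype.linearCombination B (σ ∘ y)) := by
  refine Submodule.smul_induction_on hz (fun a ha w hw => ?_) fun v w hv hw => ?_
  · have : σ ∘ (a • w) = σ a • (σ ∘ w) := funext fun i => map_mul σ _ _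
    rw [this]
    refine Submodule.smul_mem_smul (hσ.map_eq ▸ Ideal.mem_map_of_mem σ ha) ?_
    rw [LinearMap.mem_ker, linearCombination_map, LinearMap.mem_ker.1 hw, map_zero]
  · have : σ ∘ (v + w) = σ ∘ v + σ ∘ w := funext fun i => map_add σ _ _
    rw [this]
    exact add_mem hv hw

/-- If `s e` lies in `𝔪` times the syzygies over `B`, then by approximation it lies in `𝔪` times the
syzygies over `R` modulo every power of `𝔪`, and Krull's intersection theorem applies. -/
theorem IsDenseLocalHom.hasSocleGenerator_map [IsNoetherianRing R] (hσ : IsDenseLocalHom σ)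
    (hy : Ideal.span (Set.range y) = maximalIdeal R)
    (h : HasSocleGenerator (Fintype.linearCombination R y)) :
    HasSocleGenerator (Fintype.linearCombination B (σ ∘ y)) := by
  obtain ⟨s, hs, e, he⟩ := h
  refine ⟨σ s, fun b hb => ?_, σ ∘ e, fun hse => he (mem_of_forall_mem_sup_pow_smul _ fun N => ?_)⟩
  · have hle : maximalIdeal B ≤ (⊥ : Ideal B).colon {σ s} := by
      rw [← hσ.map_eq, Ideal.map_le_iff_le_comap]
      intro a ha
      rw [Ideal.mem_comap, Submodule.mem_colon_singleton, smul_eq_mul, ← map_mul, hs a ha, map_zero]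
      exact zero_mem _
    exact Submodule.mem_colon_singleton.1 (hle hb)
  · obtain ⟨z, hz, hz'⟩ := hσ.exists_mem_smul_ker hy N hse
    refine Submodule.mem_sup.2 ⟨z, hz, s • e - z, ?_, add_sub_cancel _ _⟩
    rw [mem_smul_top_pi_iff]
    refine fun i => hσ.mem_of_map_mem N _ ?_
    rw [Pi.sub_apply, map_sub, Pi.smul_apply, smul_eq_mul, map_mul]
    exact hz' i

/-- Elements of the socle of `B` are approximated by elements of the socle of `R`. An
approximation `r` satisfies `y i * r ∈ 𝔪ᴺ⁺¹` for all `i`, and the Artin–Rees lemma for the map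
`a ↦ (y i * a)ᵢ` allows to correct it. -/
theorem IsDenseLocalHom.exists_socle [IsNoetherianRing R] (hσ : IsDenseLocalHom σ)
    (hy : Ideal.span (Set.range y) = maximalIdeal R) {b : B}
    (hb : ∀ a ∈ maximalIdeal B, a * b = 0) (N : ℕ) :
    ∃ s : R, (∀ a ∈ maximalIdeal R, a * s = 0) ∧ b - σ s ∈ maximalIdeal B ^ N := by
  have hym : ∀ i, y i ∈ maximalIdeal R := fun i => hy ▸ Ideal.subset_span ⟨i, rfl⟩
  let l : R →ₗ[R] (Fin n → R) := LinearMap.pi fun i => LinearMap.mulLeft R (y i)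
  obtain ⟨k, hk⟩ := Ideal.exists_pow_inf_eq_pow_smul (maximalIdeal R) (LinearMap.range l)
  obtain ⟨r, hr⟩ := hσ.exists_sub_mem (N + k) b
  have h1 : l r ∈ maximalIdeal R ^ (N + k) • (⊤ : Submodule R (Fin n → R)) := by
    rw [mem_smul_top_pi_iff]
    refine fun i => hσ.mem_of_map_mem _ _ ?_
    have hyi : σ (y i) * b = 0 := hb _ (hσ.map_eq ▸ Ideal.mem_map_of_mem σ (hym i))
    have : σ (l r i) = -(σ (y i) * (b - σ r)) := by
      rw [mul_sub, hyi, zero_sub, neg_neg]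
      exact map_mul σ _ _
    rw [this, neg_mem_iff]
    exact Ideal.mul_mem_left _ _ hr
  have h2 : l r ∈ maximalIdeal R ^ N • LinearMap.range l := by
    have := Submodule.mem_inf.2 ⟨h1, LinearMap.mem_range_self l r⟩
    rw [hk _ (Nat.le_add_left k N), Nat.add_sub_cancel] at this
    exact Submodule.smul_mono le_rfl inf_le_right this
  rw [LinearMap.range_eq_map, ← Submodule.map_smul''] at h2
  obtain ⟨t, ht, htl⟩ := h2
  rw [smul_eq_mul, Ideal.mul_top] at ht
  refine ⟨r - t, fun a ha => ?_, ?_⟩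
  · have hle : maximalIdeal R ≤ (⊥ : Ideal R).colon {r - t} := by
      rw [← hy, Ideal.span_le]
      rintro _ ⟨i, rfl⟩
      refine Submodule.mem_colon_singleton.2 ?_
      have : l (r - t) i = 0 := by rw [map_sub, htl, sub_self, Pi.zero_apply]
      exact this
    exact Submodule.mem_colon_singleton.1 (hle ha)
  · rw [map_sub, ← sub_add]
    exact add_mem (Ideal.pow_le_pow_right (Nat.le_add_right N k) hr) (hσ.map_mem ht)

theorem IsDenseLocalHom.hasSocleGenerator_of_map [IsNoetherianRing R] [IsNoetherianRing B]
    (hσ : IsDenseLocalHom σ) (hy : Ideal.span (Set.range y) = maximalIdeal R)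
    (h : HasSocleGenerator (Fintype.linearCombination B (σ ∘ y))) :
    HasSocleGenerator (Fintype.linearCombination R y) := by
  obtain ⟨s, hs, e, he⟩ := h
  by_contra hR
  rw [HasSocleGenerator] at hR
  push Not at hR
  choose f hf using fun i => hσ.exists_sub_mem 1 (e i)
  -- modulo the maximal ideal, which kills `s`, the vector `e` comes from `R`
  have hse : s • e = s • (σ ∘ f) := funext fun i => by
    have := hs _ (pow_one (maximalIdeal B) ▸ hf i)
    rw [sub_mul, sub_eq_zero, mul_comm, mul_comm (σ _)] at this
    exact this
  refine he (mem_of_forall_mem_sup_pow_smul _ fun N => ?_)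
  obtain ⟨t, ht, htN⟩ := hσ.exists_socle hy hs N
  have h1 := hσ.comp_mem_smul_ker (hR t ht f)
  refine Submodule.mem_sup.2 ⟨_, h1, s • e - σ ∘ (t • f), ?_, add_sub_cancel _ _⟩
  rw [mem_smul_top_pi_iff]
  intro i
  have : (s • e - σ ∘ (t • f)) i = (s - σ t) * σ (f i) := by
    rw [hse, sub_mul, ← map_mul]
    rfl
  rw [this]
  exact Ideal.mul_mem_right _ _ htN

end

/-! ### Burch rings of depth zero -/

/-- A ring whose socle is nonzero has depth zero. -/
theorem HasSocleGenerator.eq_nil_of_isRegular {A : Type u} [CommRing A] [IsLocalRing A] {n : ℕ}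
    {φ : (Fin n → A) →ₗ[A] A} (h : HasSocleGenerator φ) {rs : List A}
    (hrs : RingTheory.Sequence.IsRegular A rs) : rs = [] := by
  obtain ⟨s, hs, e, he⟩ := h
  cases rs with
  | nil => rfl
  | cons r rs =>
    have hreg := ((RingTheory.Sequence.isRegular_cons_iff A r rs).1 hrs).1
    have hr : r ∈ maximalIdeal A := by
      rw [mem_maximalIdeal, mem_nonunits_iff]
      intro hu
      refine hrs.top_ne_smul ?_
      rw [Ideal.ofList_cons, Ideal.span_singleton_eq_top.2 hu, top_sup_eq, Submodule.top_smul]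
    have hs0 : s = 0 := hreg (by
      change r • s = r • 0
      rw [smul_eq_mul, hs r hr, smul_zero])
    rw [hs0, zero_smul] at he
    exact absurd (zero_mem _) he

theorem maximalIdeal_adicCompletion_ne_bot {R : Type u} [CommRing R] [IsLocalRing R]
    [IsNoetherianRing R] (hR : ¬ IsField R) :
    maximalIdeal (AdicCompletion (maximalIdeal R) R) ≠ ⊥ := fun hbot => by
  refine hR (isField_iff_maximalIdeal_eq.2 ((Submodule.eq_bot_iff _).2 fun r hr => ?_))
  have hinj : Function.Injective (algebraMap R (AdicCompletion (maximalIdeal R) R)) :=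
    AdicCompletion.of_injective (maximalIdeal R) R
  refine hinj ?_
  rw [map_zero, ← Ideal.mem_bot, ← hbot, AdicCompletion.maximalIdeal_eq_map]
  exact Ideal.mem_map_of_mem _ hr

theorem isNoetherianRing_adicCompletion (R : Type u) [CommRing R] [IsLocalRing R]
    [IsNoetherianRing R] : IsNoetherianRing (AdicCompletion (maximalIdeal R) R) := by
  obtain ⟨n, x, hx⟩ := Submodule.fg_iff_exists_fin_generating_family.1
    (maximalIdeal R).fg_of_isNoetherianRing
  refine isNoetherianRing_of_isAdicComplete
    (algebraMap R (AdicCompletion (maximalIdeal R) R) ∘ x) ?_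
  rw [Set.range_comp, ← Ideal.map_span, AdicCompletion.maximalIdeal_eq_map]
  congr 1

/-- For rings that are not fields, being a Burch ring of depth zero is the existence of a socle
generator. In one direction the completion is presented by Cohen's structure theorem. -/
theorem isBurchRing_and_depth_eq_zero_iff {R : Type u} [CommRing R] [IsLocalRing R]
    [IsNoetherianRing R] (hR : ¬ IsField R) {n : ℕ} {y : Fin n → R}
    (hy : Ideal.span (Set.range y) = maximalIdeal R) :
    (IsBurchRing R ∧ depth R = 0) ↔ HasSocleGenerator (Fintype.linearCombination R y) := by
  have hσ := isDenseLocalHom_adicCompletion R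
  have hnoeth := isNoetherianRing_adicCompletion R
  have hbot := maximalIdeal_adicCompletion_ne_bot hR
  set B := AdicCompletion (maximalIdeal R) R
  have hker : ∀ {S : Type u} [CommRing S] [IsLocalRing S] {π : S →+* B},
      Function.Surjective π → RingHom.ker π ≠ maximalIdeal S := fun {S _ _ π} hπ h => by
    refine hbot ?_
    rw [← map_maximalIdeal_of_surjective π hπ, ← h, Ideal.map_eq_bot_iff_le_ker]
  have hrange : LinearMap.range (Fintype.linearCombination B (algebraMap R B ∘ y)) =
      maximalIdeal B := by
    rw [range_linearCombination_eq, Set.range_comp, ← Ideal.map_span, hy, hσ.map_eq]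
  constructor
  · rintro ⟨⟨xs, hxs, hlen, S, _, _, I, hI, ⟨f⟩⟩, hdepth⟩
    obtain rfl : xs = [] := by
      rw [hdepth] at hlen
      exact List.eq_nil_of_length_eq_zero (by exact_mod_cast hlen)
    let g : S ⧸ I ≃+* B := f.symm.trans
      ((Ideal.quotEquivOfEq Ideal.ofList_nil).trans (RingEquiv.quotientBot B))
    let π : S →+* B := (g : S ⧸ I →+* B).comp (Ideal.Quotient.mk I)
    have hπ : Function.Surjective π := g.surjective.comp Ideal.Quotient.mk_surjective
    have hkerI : RingHom.ker π = I := by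
      exact (RingHom.ker_equiv_comp (Ideal.Quotient.mk I) g).trans Ideal.mk_ker
    exact hσ.hasSocleGenerator_of_map hy
      (IsBurchIdeal.hasSocleGenerator hπ (hker hπ) (hkerI.symm ▸ hI) hrange)
  · intro h
    have hB := hσ.hasSocleGenerator_map hy h
    have hdepth : depth R = 0 := by
      rw [depth, ENat.iSup_eq_zero]
      intro rs
      rw [ENat.iSup_eq_zero]
      intro hrs
      rw [h.eq_nil_of_isRegular hrs]
      rfl
    refine ⟨⟨[], ⟨RingTheory.Sequence.IsRegular.nil B B, fun b hb => ?_⟩, ?_, ?_⟩, hdepth⟩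
    · exact List.cons_ne_nil _ _ (hB.eq_nil_of_isRegular hb)
    · rw [hdepth]
      rfl
    · obtain ⟨S, _, _, π, hπ⟩ := exists_regular_surjection B
        (maximalIdeal B).fg_of_isNoetherianRing
      refine ⟨S, inferInstance, inferInstance, RingHom.ker π,
        HasSocleGenerator.isBurchIdeal hπ (hker hπ) hrange hB, ⟨?_⟩⟩
      exact ((Ideal.quotEquivOfEq Ideal.ofList_nil).trans (RingEquiv.quotientBot B)).trans
        (RingHom.quotientKerEquivOfSurjective hπ).symm

end BurchRings

/-- The first conjunct is the characterization of Burch rings of depth zero; the last two are its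
form for an ideal `I ≠ 𝔪`, where `[IsLocalRing (R ⧸ I)]` says exactly that `I` is proper. In each,
`F` is a minimal free resolution of the residue field and `F.syzygySucc 1` is its second syzygy. -/
theorem mainTheorem1 :
    (∀ (R : Type u) [CommRing R] [IsLocalRing R] [IsNoetherianRing R], ¬ IsField R →
      ∀ F : BurchRings.MinimalFreeResolution R (IsLocalRing.ResidueField R),
        (BurchRings.IsBurchRing R ∧ BurchRings.depth R = 0) ↔
          BurchRings.IsIsoToDirectSummand R (IsLocalRing.ResidueField R) (F.syzygySucc 1)) ∧
    (∀ (R : Type u) [CommRing R] [IsLocalRing R] [IsNoetherianRing R]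
      (I : Ideal R) [IsLocalRing (R ⧸ I)], I ≠ IsLocalRing.maximalIdeal R →
      ∀ F : BurchRings.MinimalFreeResolution (R ⧸ I) (IsLocalRing.ResidueField (R ⧸ I)),
        BurchRings.IsBurchIdeal I →
          BurchRings.IsIsoToDirectSummand (R ⧸ I) (IsLocalRing.ResidueField (R ⧸ I))
            (F.syzygySucc 1)) ∧
    (∀ (R : Type u) [CommRing R] [IsRegularLocalRing R]
      (I : Ideal R) [IsLocalRing (R ⧸ I)], I ≠ IsLocalRing.maximalIdeal R →
      ∀ F : BurchRings.MinimalFreeResolution (R ⧸ I) (IsLocalRing.ResidueField (R ⧸ I)),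
        BurchRings.IsBurchIdeal I ↔
          BurchRings.IsIsoToDirectSummand (R ⧸ I) (IsLocalRing.ResidueField (R ⧸ I))
            (F.syzygySucc 1)) := by
  have hsummand : ∀ (A : Type u) [CommRing A] [IsLocalRing A]
      (F : BurchRings.MinimalFreeResolution A (IsLocalRing.ResidueField A)),
      ∃ y : Fin (F.rank 1) → A, Ideal.span (Set.range y) = IsLocalRing.maximalIdeal A ∧
        (BurchRings.IsIsoToDirectSummand A (IsLocalRing.ResidueField A) (F.syzygySucc 1) ↔
          BurchRings.HasSocleGenerator (Fintype.linearCombination A y)) := by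
    intro A _ _ F
    obtain ⟨φ, hφ, hker⟩ := F.exists_cover
    obtain ⟨y, rfl⟩ : ∃ y, Fintype.linearCombination A y = φ :=
      ⟨fun i => φ (Pi.single i 1), LinearMap.pi_ext' fun i => LinearMap.ext_ring (by
        simp [Fintype.linearCombination_apply_single])⟩
    refine ⟨y, BurchRings.range_linearCombination_eq y ▸ hφ, ?_⟩
    rw [← hker, BurchRings.isIsoToDirectSummand_ker_iff hφ]
  have hburch : ∀ (R : Type u) [CommRing R] [IsLocalRing R] (I : Ideal R) [IsLocalRing (R ⧸ I)],
      I ≠ IsLocalRing.maximalIdeal R → BurchRings.IsBurchIdeal I →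
      ∀ F : BurchRings.MinimalFreeResolution (R ⧸ I) (IsLocalRing.ResidueField (R ⧸ I)),
        BurchRings.IsIsoToDirectSummand (R ⧸ I) (IsLocalRing.ResidueField (R ⧸ I))
          (F.syzygySucc 1) := by
    intro R _ _ I _ hI hB F
    obtain ⟨y, hy, hiff⟩ := hsummand _ F
    rw [← Ideal.mk_ker (I := I)] at hI hB
    exact hiff.2 (hB.hasSocleGenerator Ideal.Quotient.mk_surjective hI
      ((BurchRings.range_linearCombination_eq y).trans hy))
  refine ⟨fun R _ _ _ hR F => ?_, fun R _ _ _ I _ hI F hB => hburch R I hI hB F,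
    fun R _ _ I _ hI F => ⟨fun hB => hburch R I hI hB F, fun h => ?_⟩⟩
  · obtain ⟨y, hy, hiff⟩ := hsummand R F
    rw [hiff, BurchRings.isBurchRing_and_depth_eq_zero_iff hR hy]
  · obtain ⟨y, hy, hiff⟩ := hsummand _ F
    rw [← Ideal.mk_ker (I := I)] at hI ⊢
    exact (hiff.1 h).isBurchIdeal Ideal.Quotient.mk_surjective hI
      ((BurchRings.range_linearCombination_eq y).trans hy)
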